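/- Let $G=(V,E)$ be a finite simple graph with $V=\{0,\dots,n-1\}$ and $m=|E|$, let $\varepsilon>0$, and let $\theta(v)\in\mathbb R$ be a threshold for each $v\in V$. For $S\subseteq V$ let $d_S(v)$ be the number of neighbours of $v$ in $S$. Let $\mathrm{Lap}(b)$ be the distribution with density $\frac1{2b}e^{-|x|/b}$, and for $0<q\le 1$ let $\mathrm{Geom}(q)$ be the distribution on $\{1,2,\dots\}$ with $\Pr[\mathrm{Geom}(q)=j]=(1-q)^{j-1}q$. *Naive loop.* Put $V_0=V$, $t=0$. Repeat: $t\leftarrow t+1$, $V_t\leftarrow V_{t-1}$; for each $v\in V_{t-1}$ draw a fresh independent $\nu_{t,v}\sim\mathrm{Lap}(8/\varepsilon)$ and, if $d_{V_{t-1}}(v)+\nu_{t,v}\le\theta(v)$, remove $v$ from $V_t$; until $V_{t-1}\setminus V_t=\emptyset$. *Resampling loop.* Put $t=0$, $V_0=V$, $\text{to-remove}(s)=\emptyset$ for all $s$, $\text{remove-time}(v)=n$ for all $v$, $\text{updated}=V$. Repeat: (i) for each $v\in\text{updated}$, delete $v$ from $\text{to-remove}(\text{remove-time}(v))$, let $q=\Pr[d_{V_t}(v)+\mathrm{Lap}(8/\varepsilon)\le\theta(v)]$,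 set $\text{remove-time}(v)\leftarrow t+\mathrm{Geom}(q)$ with a fresh independent draw, and add $v$ to $\text{to-remove}(\text{remove-time}(v))$; (ii) $\text{updated}\leftarrow\emptyset$, $t\leftarrow t+1$, $V_t\leftarrow V_{t-1}$; (iii) for each $v\in\text{to-remove}(t)$, remove $v$ from $V_t$ and add all neighbours of $v$ that are currently in $V_t$ to $\text{updated}$; until $V_{t-1}\setminus V_t=\emptyset$. (All for-loops go through their set in increasing order.) Then the following hold. 1. Both loops end after at most $n+1$ rounds. The sequence $(V_0,V_1,\dots)$ up to any number of rounds, together with the information whether the loop has ended, has the same distribution in both loops; in particular the final set has the same distribution in both. 2. The resampling loop can be implemented in $\tilde O(n+m)$ time. Precisely: (a) there is an absolute constant $C$ such that the resampling loop always performs at most $C(n+m+1)$ operations, where one resampling of a vertex in (i) counts 1, one removal of $v$ in (iii) counts $1+d_V(v)$, and each round counts 1; and (b) there are a fixed program $P$ and absolute constants $C,a$ such that for all $n,G,\varepsilon,\theta$, given $n$, $\varepsilon$, $\theta$ and adjacency lists of $G$ (in any order), $P$ halts with probability one within $C(n+m+1)\log^a(n+m+2)$ steps (with $\log=\lfloor\log_2\rfloor$)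 and outputs the number $T$ of rounds and the removal round of each vertex, i.e. $(V_0,\dots,V_T)$, with the distribution of the resampling loop. The program runs on a unit-cost random access machine whose registers and arrays hold natural numbers (with $+$, truncated $-$, comparison, indexing) and reals (with $+,-,\cdot,/,\exp$, comparison, and conversion from naturals), and which can draw from $\mathrm{Geom}(q)$ in one step. -/

import Mathlib

open MeasureTheory ProbabilityTheory

noncomputable section

namespace Peeling

/-! ### The two distributions -/

/-- The Laplace distribution `Lap(b)`, with density `exp (-|x| / b) / (2 b)`. -/
def laplace (b : ℝ) : Measure ℝ :=
  volume.withDensity fun x => ENNReal.ofReal (Real.exp (-|x| / b) / (2 * b))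

theorem isProbabilityMeasure_laplace {b : ℝ} (hb : 0 < b) :
    IsProbabilityMeasure (laplace b) := by
  have hne : b ≠ 0 := hb.ne'
  have hI : ∫ x : ℝ, Real.exp (-|x| / b) / (2 * b) = 1 := by
    rw [integral_comp_abs (f := fun x => Real.exp (-x / b) / (2 * b)), integral_div]
    have h := integral_exp_mul_Ioi (a := -b⁻¹) (by simpa using hb) 0
    have h2 : ∀ x : ℝ, Real.exp (-x / b) = Real.exp (-b⁻¹ * x) := by
      intro x; congr 1; field_simp
    simp_rw [h2, h]
    simp
    field_simp
  have hint : Integrable fun x : ℝ => Real.exp (-|x| / b) / (2 * b) := by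
    by_contra h
    rw [integral_undef h] at hI
    exact zero_ne_one hI
  refine ⟨?_⟩
  rw [laplace, withDensity_apply _ MeasurableSet.univ, Measure.restrict_univ,
    ← ofReal_integral_eq_lintegral_ofReal hint, hI, ENNReal.ofReal_one]
  exact Filter.Eventually.of_forall fun x => by positivity

/-- `Geom(q)`, the number of independent trials of success probability `q` up to and including
the first success, so that `Pr[Geom(q) = j + 1] = (1 - q) ^ j * q`. It is meant for `0 < q ≤ 1`;
other values of `q` are clamped to `[0, 1]`, and `Geom(0)` is by convention the constant `1`. -/
def geom (q : ℝ) : PMF ℕ :=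
  (geometricMeasure (Set.projIcc 0 1 zero_le_one q)).toPMF.map (· + 1)

/-! ### Repeat-until loops over randomized rounds -/

/-- A loop that maintains a set `V_t` of vertices: its current state, the list
`[V_0, V_1, ..., V_t]` of the sets seen so far, and whether the loop has been left. -/
structure LoopCfg (σ : Type) (n : ℕ) where
  state : σ
  trace : List (Finset (Fin n))
  done : Bool

/-- One more round of `repeat body until V_{t-1} - V_t = ∅`; nothing happens once the loop has
been left. -/
def LoopCfg.next {σ : Type} {n : ℕ} (body : σ → PMF σ) (cur : σ → Finset (Fin n))
    (c : LoopCfg σ n) : PMF (LoopCfg σ n) :=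
  if c.done = true then pure c
  else do
    let s ← body c.state
    pure ⟨s, c.trace ++ [cur s], decide (cur c.state \ cur s = ∅)⟩

/-- The loop, entered in state `s₀`, after (at most) `k` rounds. -/
def loopRun {σ : Type} {n : ℕ} (body : σ → PMF σ) (cur : σ → Finset (Fin n)) (s₀ : σ) :
    ℕ → PMF (LoopCfg σ n)
  | 0 => pure ⟨s₀, [cur s₀], false⟩
  | k + 1 => do
    let c ← loopRun body cur s₀ k
    c.next body cur

/-! ### The naive peeling loop -/

/-- The neighbours of `v` inside `S`. -/
def nbrsIn {n : ℕ} (G : SimpleGraph (Fin n)) (S : Finset (Fin n)) (v : Fin n) :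
    Finset (Fin n) :=
  open Classical in S.filter fun w => G.Adj v w

/-- The induced degree `d_S(v)`. -/
def indDeg {n : ℕ} (G : SimpleGraph (Fin n)) (S : Finset (Fin n)) (v : Fin n) : ℕ :=
  (nbrsIn G S v).card

theorem measurable_noisyTest (d θ : ℝ) : Measurable fun ν : ℝ => decide (d + ν ≤ θ) := by
  refine measurable_to_bool ?_
  have : (fun ν : ℝ => decide (d + ν ≤ θ)) ⁻¹' {true} = Set.Iic (θ - d) := by
    ext x; simp [le_sub_iff_add_le']
  rw [this]
  exact measurableSet_Iic

/-- Draw `ν ← Lap(8 / ε)` afresh and return the truth value of `d + ν ≤ θ`. -/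
def noisyTest (ε : ℝ) (hε : 0 < ε) (d θ : ℝ) : PMF Bool :=
  haveI := isProbabilityMeasure_laplace (b := 8 / ε) (by positivity)
  haveI : IsProbabilityMeasure ((laplace (8 / ε)).map fun ν => decide (d + ν ≤ θ)) :=
    Measure.isProbabilityMeasure_map (measurable_noisyTest d θ).aemeasurable
  ((laplace (8 / ε)).map fun ν => decide (d + ν ≤ θ)).toPMF

/-- One round of the naive loop: `V_t ← V_{t-1}`, then for each `v ∈ V_{t-1}` draw
`ν ← Lap(8 / ε)` and remove `v` from `V_t` if `d_{V_{t-1}}(v) + ν ≤ thr v`. -/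
def naiveBody {n : ℕ} (G : SimpleGraph (Fin n)) (ε : ℝ) (hε : 0 < ε) (thr : Fin n → ℝ)
    (V : Finset (Fin n)) : PMF (Finset (Fin n)) :=
  (V.sort (· ≤ ·)).foldlM (init := V) fun W v => do
    let b ← noisyTest ε hε (indDeg G V v) (thr v)
    pure (if b = true then W.erase v else W)

/-- The naive loop on `G`, from `V_0 = V`, after at most `k` rounds. -/
def naiveRun {n : ℕ} (G : SimpleGraph (Fin n)) (ε : ℝ) (hε : 0 < ε) (thr : Fin n → ℝ) :
    ℕ → PMF (LoopCfg (Finset (Fin n)) n) :=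
  loopRun (naiveBody G ε hε thr) id Finset.univ

/-! ### The loop with geometric resampling -/

/-- The variables of the loop with geometric resampling, and a counter `work` of the executed
lines, on which the loop does not depend: a resampling counts `1`, the removal of `v` counts `1`
plus the number of neighbours of `v` that have to be scanned, and a round counts `1`. -/
structure EffState (n : ℕ) where
  t : ℕ
  V : Finset (Fin n)
  toRemove : ℕ → Finset (Fin n)
  removeTime : Fin n → ℕ
  updated : Finset (Fin n)
  work : ℕ

def EffState.start (n : ℕ) : EffState n where
  t := 0
  V := Finset.univ
  toRemove := fun _ => ∅
  removeTime := fun _ => n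
  updated := Finset.univ
  work := 0

/-- Take `v` out of `toRemove (removeTime v)`, compute the probability `q` that
`d_{V_t}(v) + Lap(8 / ε) ≤ thr v`, set `removeTime v ← t + Geom(q)`, and put `v` into
`toRemove (removeTime v)`. -/
def resample {n : ℕ} (G : SimpleGraph (Fin n)) (ε : ℝ) (thr : Fin n → ℝ)
    (s : EffState n) (v : Fin n) : PMF (EffState n) := do
  let old := Function.update s.toRemove (s.removeTime v) ((s.toRemove (s.removeTime v)).erase v)
  let q := (laplace (8 / ε)).real {ν : ℝ | (indDeg G s.V v : ℝ) + ν ≤ thr v}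
  let g ← geom q
  pure { s with
    toRemove := Function.update old (s.t + g) (insert v (old (s.t + g)))
    removeTime := Function.update s.removeTime v (s.t + g)
    work := s.work + 1 }

/-- Remove `v` from `V_t` and add all neighbours of `v` in `V_t` to `updated`. -/
def removeVertex {n : ℕ} (G : SimpleGraph (Fin n)) (s : EffState n) (v : Fin n) : EffState n :=
  { s with
    V := s.V.erase v
    updated := s.updated ∪ nbrsIn G (s.V.erase v) v
    work := s.work + 1 + indDeg G Finset.univ v }

/-- One round: resample the removal time of each `v ∈ updated`, which empties `updated`;
advance `t`; process the vertices in `toRemove t`. -/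
def effBody {n : ℕ} (G : SimpleGraph (Fin n)) (ε : ℝ) (thr : Fin n → ℝ)
    (s : EffState n) : PMF (EffState n) := do
  let s₁ ← (s.updated.sort (· ≤ ·)).foldlM (resample G ε thr) s
  let s₂ : EffState n := { s₁ with t := s₁.t + 1, updated := ∅, work := s₁.work + 1 }
  pure (((s₂.toRemove s₂.t).sort (· ≤ ·)).foldl (removeVertex G) s₂)

/-- The loop with geometric resampling on `G`, after at most `k` rounds. -/
def effRun {n : ℕ} (G : SimpleGraph (Fin n)) (ε : ℝ) (thr : Fin n → ℝ) :
    ℕ → PMF (LoopCfg (EffState n) n) :=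
  loopRun (effBody G ε thr) EffState.V (EffState.start n)

/-- What is observed of a loop: the sets `V_0, ..., V_t` and whether the loop has been left. -/
def LoopCfg.observe {σ : Type} {n : ℕ} (c : LoopCfg σ n) : List (Finset (Fin n)) × Bool :=
  (c.trace, c.done)

/-! ### A randomized real RAM

Registers and arrays hold natural numbers or reals. Naturals can be added, subtracted, compared
and used as addresses; reals can be added, subtracted, multiplied, divided, exponentiated and
compared. A natural can be converted to a real; the only way back is the instruction that
draws from `Geom(q)`. One instruction or one test is one step; a program is a fixed finite
text, so the expressions in it have bounded size. -/

/-- The memory. -/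
structure Store where
  natReg : ℕ → ℕ
  natArr : ℕ → ℕ → ℕ
  realReg : ℕ → ℝ
  realArr : ℕ → ℕ → ℝ

inductive NExp where
  | const (k : ℕ)
  | reg (x : ℕ)
  | get (a : ℕ) (i : NExp)
  | add (e f : NExp)
  | sub (e f : NExp)

def NExp.eval (σ : Store) : NExp → ℕ
  | .const k => k
  | .reg x => σ.natReg x
  | .get a i => σ.natArr a (i.eval σ)
  | .add e f => e.eval σ + f.eval σ
  | .sub e f => e.eval σ - f.eval σ

inductive RExp where
  | ofNat (e : NExp)
  | reg (x : ℕ)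
  | get (a : ℕ) (i : NExp)
  | add (e f : RExp)
  | sub (e f : RExp)
  | mul (e f : RExp)
  | div (e f : RExp)
  | exp (e : RExp)

def RExp.eval (σ : Store) : RExp → ℝ
  | .ofNat e => (e.eval σ : ℝ)
  | .reg x => σ.realReg x
  | .get a i => σ.realArr a (i.eval σ)
  | .add e f => e.eval σ + f.eval σ
  | .sub e f => e.eval σ - f.eval σ
  | .mul e f => e.eval σ * f.eval σ
  | .div e f => e.eval σ / f.eval σ
  | .exp e => Real.exp (e.eval σ)

inductive BExp where
  | natLe (e f : NExp)
  | realLe (e f : RExp)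
  | not (b : BExp)
  | and (b c : BExp)

def BExp.holds (σ : Store) : BExp → Prop
  | .natLe e f => e.eval σ ≤ f.eval σ
  | .realLe e f => e.eval σ ≤ f.eval σ
  | .not b => ¬ b.holds σ
  | .and b c => b.holds σ ∧ c.holds σ

inductive Cmd where
  | skip
  | setNat (x : ℕ) (e : NExp)
  | putNat (a : ℕ) (i e : NExp)
  | setReal (x : ℕ) (e : RExp)
  | putReal (a : ℕ) (i : NExp) (e : RExp)
  | sampleGeom (x : ℕ) (q : RExp)
  | seq (c d : Cmd)
  | ite (b : BExp) (c d : Cmd)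
  | while (b : BExp) (c : Cmd)

def Store.setNat (σ : Store) (x v : ℕ) : Store :=
  { σ with natReg := Function.update σ.natReg x v }

def Store.putNat (σ : Store) (a i v : ℕ) : Store :=
  { σ with natArr := Function.update σ.natArr a (Function.update (σ.natArr a) i v) }

def Store.setReal (σ : Store) (x : ℕ) (v : ℝ) : Store :=
  { σ with realReg := Function.update σ.realReg x v }

def Store.putReal (σ : Store) (a i : ℕ) (v : ℝ) : Store :=
  { σ with realArr := Function.update σ.realArr a (Function.update (σ.realArr a) i v) }

/-- One step of the machine. A configuration is the list of the commands still to be executed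
and the memory; the machine has halted when the list is empty. -/
def step : List Cmd × Store → PMF (List Cmd × Store)
  | ([], σ) => pure ([], σ)
  | (.skip :: K, σ) => pure (K, σ)
  | (.setNat x e :: K, σ) => pure (K, σ.setNat x (e.eval σ))
  | (.putNat a i e :: K, σ) => pure (K, σ.putNat a (i.eval σ) (e.eval σ))
  | (.setReal x e :: K, σ) => pure (K, σ.setReal x (e.eval σ))
  | (.putReal a i e :: K, σ) => pure (K, σ.putReal a (i.eval σ) (e.eval σ))
  | (.sampleGeom x q :: K, σ) => do
    let g ← geom (q.eval σ)
    pure (K, σ.setNat x g)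
  | (.seq c d :: K, σ) => pure (c :: d :: K, σ)
  | (.ite b c d :: K, σ) =>
    open Classical in pure (if b.holds σ then c :: K else d :: K, σ)
  | (.while b c :: K, σ) =>
    open Classical in pure (if b.holds σ then c :: .while b c :: K else K, σ)

/-- The configuration after `T` steps. -/
def runFor (p : List Cmd × Store) : ℕ → PMF (List Cmd × Store)
  | 0 => pure p
  | T + 1 => do
    let p' ← runFor p T
    step p'

/-- `nbrs v` lists the neighbours of `v`, in any order and without repetition. -/
def IsAdjacencyLists {n : ℕ} (G : SimpleGraph (Fin n)) (nbrs : Fin n → List (Fin n)) : Prop :=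
  ∀ v, (nbrs v).Nodup ∧ ∀ w, w ∈ nbrs v ↔ G.Adj v w

/-- The input: natural register `0` holds `n`, real register `0` holds `ε`, real array `0` holds
the thresholds, natural array `1` holds the concatenated adjacency lists, and cell `v ≤ n` of
natural array `0` holds the position at which the list of `v` starts in it (so the list of `v`
ends just before the position in cell `v + 1`). All other cells are `0`. -/
def inputStore {n : ℕ} (nbrs : Fin n → List (Fin n)) (ε : ℝ) (thr : Fin n → ℝ) : Store where
  natReg := fun x => if x = 0 then n else 0
  natArr := fun a i =>
    if a = 0 then (if i ≤ n then ((List.ofFn nbrs).take i).flatten.length else 0)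
    else if a = 1 then ((List.ofFn nbrs).flatten.map Fin.val).getD i 0
    else 0
  realReg := fun x => if x = 0 then ε else 0
  realArr := fun a i => if h : a = 0 ∧ i < n then thr ⟨i, h.2⟩ else 0

/-- The output: natural register `1` holds the number `T` of rounds, and cell `v` of natural
array `2` holds the round in which `v` was removed, or `0` if `v ∈ V_T`. This encodes the sets
`[V_0, ..., V_T]`. There is no output (`none`) unless the machine has halted. -/
def outputTrace (n : ℕ) (p : List Cmd × Store) : Option (List (Finset (Fin n))) :=
  if p.1.isEmpty = true then
    some ((List.range (p.2.natReg 1 + 1)).map fun s =>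
      Finset.univ.filter fun v : Fin n => p.2.natArr 2 v = 0 ∨ s < p.2.natArr 2 v)
  else none

end Peeling

end

/-! The removal round of a vertex whose degree never changes is the first success in a sequence of
independent coin tosses, hence geometric. By memorylessness, it does not matter whether the coins
are tossed round by round or the removal rounds of all current vertices are drawn at once and
drawn again after each round; moreover, a removal round that has not been reached need not be drawn
again as long as the degree of its vertex is unchanged. The naive loop thus has the law of any loop
that draws again, after each round, at least the vertices that have lost a neighbour.

A vertex is drawn again only after the loss of a neighbour, so there are at most `n + 2 m` draws.
The program keeps for each round a linked list of the vertices due in it, decrements a stored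
degree and draws again each time an edge to a removed vertex is scanned, and skips outdated list
entries. It may thus draw a vertex several times in a round; only the last draw matters.
-/

noncomputable section

namespace Peeling

/-! ### Redrawing independent coordinates -/

theorem pmf_bind_congr {α β : Type*} (p : PMF α) {f g : α → PMF β}
    (h : ∀ a ∈ p.support, f a = g a) : p.bind f = p.bind g := by
  ext b
  rw [PMF.bind_apply, PMF.bind_apply]
  refine tsum_congr fun a => ?_
  by_cases ha : a ∈ p.support
  · rw [h a ha]
  · rw [(PMF.apply_eq_zero_iff p a).2 ha, zero_mul, zero_mul]

theorem pmf_map_congr {α β : Type*} (p : PMF α) {f g : α → β}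
    (h : ∀ a ∈ p.support, f a = g a) : p.map f = p.map g :=
  pmf_bind_congr p fun a ha => by rw [Function.comp_apply, Function.comp_apply, h a ha]

section Redraw

variable {ι α : Type*} [DecidableEq ι]

/-- The random family obtained from `x` by replacing, in turn, the coordinates in a list by fresh
draws, the one at `v` from `μ v`. -/
def redrawList (μ : ι → PMF α) : List ι → (ι → α) → PMF (ι → α)
  | [], x => PMF.pure x
  | v :: l, x => (μ v).bind fun a => redrawList μ l (Function.update x v a)

/-- The random family obtained from `x` by replacing the coordinates in a finite set by
independent fresh draws, the one at `v` from `μ v`. -/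
def redraw (μ : ι → PMF α) (S : Finset ι) (x : ι → α) : PMF (ι → α) :=
  redrawList μ S.toList x

theorem redrawList_perm (μ : ι → PMF α) {l l' : List ι} (h : l.Perm l') :
    redrawList μ l = redrawList μ l' := by
  induction h with
  | nil => rfl
  | cons v _ ih => funext x; simp only [redrawList, ih]
  | swap v w l =>
    funext x
    rcases eq_or_ne v w with rfl | hvw
    · rfl
    · simp only [redrawList]
      rw [PMF.bind_comm]
      simp only [Function.update_comm hvw]
  | trans _ _ ih₁ ih₂ => rw [ih₁, ih₂]

theorem redrawList_update_of_mem (μ : ι → PMF α) {l : List ι} {v : ι} (hv : v ∈ l) (x : ι → α)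
    (a : α) : redrawList μ l (Function.update x v a) = redrawList μ l x := by
  induction l generalizing x with
  | nil => simp at hv
  | cons w l ih =>
    rcases eq_or_ne v w with rfl | hvw
    · simp only [redrawList, Function.update_idem]
    · simp only [redrawList, Function.update_comm hvw,
        ih ((List.mem_cons.1 hv).resolve_left hvw)]

theorem redrawList_eq_redraw (μ : ι → PMF α) {l : List ι} {S : Finset ι} (hl : l.Nodup)
    (hS : ∀ v, v ∈ l ↔ v ∈ S) : redrawList μ l = redraw μ S :=
  redrawList_perm μ <| (List.perm_ext_iff_of_nodup hl S.nodup_toList).2 <| by simpa using hS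

theorem redraw_empty (μ : ι → PMF α) (x : ι → α) : redraw μ ∅ x = PMF.pure x := by
  rw [redraw, Finset.toList_empty, redrawList]

theorem redraw_update_of_mem (μ : ι → PMF α) {S : Finset ι} {v : ι} (hv : v ∈ S) (x : ι → α)
    (a : α) : redraw μ S (Function.update x v a) = redraw μ S x :=
  redrawList_update_of_mem μ (Finset.mem_toList.2 hv) x a

theorem redraw_insert (μ : ι → PMF α) (v : ι) (S : Finset ι) (x : ι → α) :
    redraw μ (insert v S) x = (μ v).bind fun a => redraw μ S (Function.update x v a) := by
  by_cases hv : v ∈ S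
  · simp only [Finset.insert_eq_of_mem hv, redraw_update_of_mem μ hv, PMF.bind_const]
  · rw [redraw, redrawList_perm μ (Finset.toList_insert hv)]
    rfl

theorem redraw_congr {μ μ' : ι → PMF α} {S : Finset ι} (h : ∀ v ∈ S, μ v = μ' v) (x : ι → α) :
    redraw μ S x = redraw μ' S x := by
  induction S using Finset.induction_on generalizing x with
  | empty => rw [redraw_empty, redraw_empty]
  | insert v S _ ih =>
    rw [redraw_insert, redraw_insert, h v (S.mem_insert_self v)]
    simp only [ih fun w hw => h w (Finset.mem_insert_of_mem hw)]

theorem mem_support_redraw {μ : ι → PMF α} {S : Finset ι} {x y : ι → α}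
    (hy : y ∈ (redraw μ S x).support) :
    (∀ v ∉ S, y v = x v) ∧ ∀ v ∈ S, y v ∈ (μ v).support := by
  induction S using Finset.induction_on generalizing x with
  | empty =>
    rw [redraw_empty, PMF.mem_support_pure_iff] at hy
    simp [hy]
  | insert v S hv ih =>
    rw [redraw_insert, PMF.mem_support_bind_iff] at hy
    obtain ⟨a, ha, hy⟩ := hy
    obtain ⟨hkept, hdrawn⟩ := ih hy
    refine ⟨fun w hw => ?_, fun w hw => ?_⟩
    · obtain ⟨hwv, hwS⟩ := not_or.1 (mt Finset.mem_insert.2 hw)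
      rw [hkept w hwS, Function.update_of_ne hwv]
    · rcases Finset.mem_insert.1 hw with rfl | hwS
      · rwa [hkept w hv, Function.update_self]
      · exact hdrawn w hwS

theorem redraw_bind_redraw {μ μ' : ι → PMF α} {S U : Finset ι} (h : ∀ v ∈ S \ U, μ v = μ' v)
    (x : ι → α) : (redraw μ S x).bind (redraw μ' U) = redraw μ' (S ∪ U) x := by
  induction S using Finset.induction_on generalizing x with
  | empty => rw [redraw_empty, PMF.pure_bind, Finset.empty_union]
  | insert v S _ ih =>
    have hS : ∀ w ∈ S \ U, μ w = μ' w := fun w hw =>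
      h w (Finset.sdiff_subset_sdiff (S.subset_insert v) subset_rfl hw)
    rw [redraw_insert, PMF.bind_bind, Finset.insert_union, redraw_insert]
    simp only [ih hS]
    by_cases hv : v ∈ U
    · simp only [redraw_update_of_mem μ' (Finset.mem_union_right S hv), PMF.bind_const]
    · rw [h v (Finset.mem_sdiff.2 ⟨S.mem_insert_self v, hv⟩)]

theorem redraw_eq_bind_redraw {β : Type*} {μ : ι → PMF α} {κ : ι → PMF β} {ν : ι → β → PMF α}
    (h : ∀ v, μ v = (κ v).bind (ν v)) (S : Finset ι) (x : ι → α) (y : ι → β) :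
    redraw μ S x = (redraw κ S y).bind fun b => redraw (fun v => ν v (b v)) S x := by
  induction S using Finset.induction_on generalizing x y with
  | empty => simp only [redraw_empty, PMF.pure_bind]
  | insert v S hv ih =>
    rw [redraw_insert, redraw_insert, h v, PMF.bind_bind, PMF.bind_bind]
    refine congrArg _ (funext fun a => ?_)
    rw [pmf_bind_congr (g := fun b : ι → β => (ν v a).bind fun a' =>
      redraw (fun v => ν v (b v)) S (Function.update x v a')) _ fun b hb => ?_]
    · rw [PMF.bind_comm]
      simp only [← ih]
    · rw [redraw_insert, (mem_support_redraw hb).1 v hv, Function.update_self]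

theorem redraw_of_pure {μ : ι → PMF α} {y : ι → α} {T : Finset ι}
    (h : ∀ v ∈ T, μ v = PMF.pure (y v)) (x : ι → α) :
    redraw μ T x = PMF.pure (T.piecewise y x) := by
  induction T using Finset.induction_on generalizing x with
  | empty => rw [redraw_empty, Finset.piecewise_empty]
  | insert v T hv ih =>
    rw [redraw_insert, h v (T.mem_insert_self v), PMF.pure_bind,
      ih fun w hw => h w (Finset.mem_insert_of_mem hw)]
    congr 1
    ext w
    rcases eq_or_ne w v with rfl | hwv <;> simp [Finset.piecewise, *]

theorem redraw_eq_redraw_sdiff {μ : ι → PMF α} {y : ι → α} {S T : Finset ι} (hTS : T ⊆ S)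
    (h : ∀ v ∈ T, μ v = PMF.pure (y v)) (x : ι → α) :
    redraw μ S x = redraw μ (S \ T) (T.piecewise y x) := by
  rw [← Finset.union_sdiff_of_subset hTS, ← redraw_bind_redraw (μ := μ) (fun _ _ => rfl),
    redraw_of_pure h, PMF.pure_bind, Finset.union_sdiff_cancel_left Finset.disjoint_sdiff]

end Redraw

/-! ### Loops -/

section Loops

variable {σ : Type} {n : ℕ} {body : σ → PMF σ} {cur : σ → Finset (Fin n)}

/-- The loop, continued from a given configuration for `k` rounds. Unlike `loopRun` it recurses on
the first of these rounds. -/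
def loopFrom (body : σ → PMF σ) (cur : σ → Finset (Fin n)) :
    ℕ → LoopCfg σ n → PMF (LoopCfg σ n)
  | 0, c => PMF.pure c
  | k + 1, c => (c.next body cur).bind (loopFrom body cur k)

theorem LoopCfg.next_of_done {c : LoopCfg σ n} (hc : c.done = true) :
    c.next body cur = PMF.pure c :=
  if_pos hc

theorem LoopCfg.next_of_not_done {c : LoopCfg σ n} (hc : c.done = false) :
    c.next body cur = (body c.state).map fun s =>
      ⟨s, c.trace ++ [cur s], decide (cur c.state \ cur s = ∅)⟩ :=
  if_neg (by simp [hc])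

theorem loopFrom_succ_last (k : ℕ) (c : LoopCfg σ n) :
    loopFrom body cur (k + 1) c = (loopFrom body cur k c).bind fun c' => c'.next body cur := by
  induction k generalizing c with
  | zero =>
    simp only [loopFrom, PMF.pure_bind]
    exact PMF.bind_pure _
  | succ k ih =>
    rw [loopFrom, loopFrom, PMF.bind_bind]
    exact congrArg _ (funext ih)

theorem loopRun_eq_loopFrom (s₀ : σ) (k : ℕ) :
    loopRun body cur s₀ k = loopFrom body cur k ⟨s₀, [cur s₀], false⟩ := by
  induction k with
  | zero => rfl
  | succ k ih =>
    rw [loopFrom_succ_last, ← ih]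
    rfl

theorem loopFrom_of_done (k : ℕ) {c : LoopCfg σ n} (hc : c.done = true) :
    loopFrom body cur k c = PMF.pure c := by
  induction k with
  | zero => rfl
  | succ k ih => rw [loopFrom, LoopCfg.next_of_done hc, PMF.pure_bind, ih]

theorem loopFrom_succ (k : ℕ) (s : σ) (tr : List (Finset (Fin n))) :
    loopFrom body cur (k + 1) ⟨s, tr, false⟩ = (body s).bind fun s' =>
      loopFrom body cur k ⟨s', tr ++ [cur s'], decide (cur s \ cur s' = ∅)⟩ := by
  rw [loopFrom, LoopCfg.next_of_not_done rfl, PMF.bind_map]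
  rfl

theorem loopRun_induction {s₀ : σ} {P : ℕ → LoopCfg σ n → Prop}
    (zero : P 0 ⟨s₀, [cur s₀], false⟩)
    (done : ∀ k c, c.done = true → P k c → P (k + 1) c)
    (step : ∀ k c, c.done = false → P k c → ∀ s ∈ (body c.state).support,
      P (k + 1) ⟨s, c.trace ++ [cur s], decide (cur c.state \ cur s = ∅)⟩) (k : ℕ) :
    ∀ c ∈ (loopRun body cur s₀ k).support, P k c := by
  induction k with
  | zero =>
    intro c hc
    rwa [(PMF.mem_support_pure_iff _ c).1 hc]
  | succ k ih =>
    intro c' hc'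
    obtain ⟨c, hc, hnext⟩ := (PMF.mem_support_bind_iff _ _ c').1 hc'
    cases hd : c.done
    · rw [LoopCfg.next_of_not_done hd, PMF.mem_support_map_iff] at hnext
      obtain ⟨s, hs, rfl⟩ := hnext
      exact step k c hd (ih c hc) s hs
    · rw [LoopCfg.next_of_done hd, PMF.mem_support_pure_iff] at hnext
      exact hnext ▸ done k c hd (ih c hc)

theorem getLast_trace_of_mem_support_loopRun (s₀ : σ) (k : ℕ) :
    ∀ c ∈ (loopRun body cur s₀ k).support, c.trace.getLast? = some (cur c.state) :=
  loopRun_induction (P := fun _ c => c.trace.getLast? = some (cur c.state)) rfl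
    (fun _ _ _ h => h) (fun _ _ _ _ _ _ => List.getLast?_concat) k

theorem map_cur_loopRun (s₀ : σ) (k : ℕ) :
    (loopRun body cur s₀ k).map (fun c => cur c.state) =
      ((loopRun body cur s₀ k).map LoopCfg.observe).map fun o => o.1.getLast?.getD ∅ := by
  rw [PMF.map_comp]
  refine pmf_map_congr _ fun c hc => ?_
  rw [Function.comp_apply, LoopCfg.observe, getLast_trace_of_mem_support_loopRun s₀ k c hc,
    Option.getD_some]

theorem done_of_mem_support_loopRun (hbody : ∀ s, ∀ s' ∈ (body s).support, cur s' ⊆ cur s)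
    (s₀ : σ) : ∀ c ∈ (loopRun body cur s₀ (n + 1)).support, c.done = true := by
  intro c hc
  have hcard : c.done = true ∨ (cur c.state).card + (n + 1) ≤ n := by
    refine loopRun_induction (P := fun k c => c.done = true ∨ (cur c.state).card + k ≤ n)
      (Or.inr <| card_finset_fin_le (cur s₀)) (fun k c hd _ => Or.inl hd)
      (fun k c hd h s hs => ?_) (n + 1) c hc
    refine or_iff_not_imp_left.2 fun hne => ?_
    have hlt : (cur s).card < (cur c.state).card := Finset.card_lt_card
      ⟨hbody _ s hs, fun hsub => hne (by simpa [Finset.sdiff_eq_empty_iff_subset] using hsub)⟩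
    have := h.resolve_left (by simp [hd])
    dsimp only
    omega
  exact hcard.resolve_right (by omega)

end Loops

/-! ### The Laplace and geometric distributions -/

theorem laplace_real_apply {b : ℝ} (hb : 0 < b) {s : Set ℝ} (hs : MeasurableSet s) :
    (laplace b).real s = ∫ x in s, Real.exp (-|x| / b) / (2 * b) := by
  rw [Measure.real, laplace, withDensity_apply _ hs, integral_eq_lintegral_of_nonneg_ae]
  · exact Filter.Eventually.of_forall fun x => by positivity
  · exact (by fun_prop : Continuous fun x : ℝ =>
      Real.exp (-|x| / b) / (2 * b)).aestronglyMeasurable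

theorem laplace_real_Iic_of_nonpos {b : ℝ} (hb : 0 < b) {x : ℝ} (hx : x ≤ 0) :
    (laplace b).real (Set.Iic x) = Real.exp (x / b) / 2 := by
  have hdensity : ∀ y ∈ Set.Iic x,
      Real.exp (-|y| / b) / (2 * b) = Real.exp (b⁻¹ * y) / (2 * b) := by
    intro y hy
    rw [abs_of_nonpos (le_trans hy hx), neg_neg, div_eq_inv_mul y b]
  rw [laplace_real_apply hb measurableSet_Iic, setIntegral_congr_fun measurableSet_Iic hdensity,
    integral_div, integral_exp_mul_Iic (inv_pos.2 hb), ← div_eq_inv_mul]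
  field_simp

theorem laplace_real_Iic_of_nonneg {b : ℝ} (hb : 0 < b) {x : ℝ} (hx : 0 ≤ x) :
    (laplace b).real (Set.Iic x) = 1 - Real.exp (-x / b) / 2 := by
  have := isProbabilityMeasure_laplace hb
  have hdensity : ∀ y ∈ Set.Ioi x,
      Real.exp (-|y| / b) / (2 * b) = Real.exp (-b⁻¹ * y) / (2 * b) := by
    intro y hy
    rw [abs_of_nonneg (le_trans hx (le_of_lt hy)), neg_div, neg_mul, div_eq_inv_mul y b]
  have hupper : (laplace b).real (Set.Ioi x) = Real.exp (-x / b) / 2 := by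
    rw [laplace_real_apply hb measurableSet_Ioi, setIntegral_congr_fun measurableSet_Ioi hdensity,
      integral_div, integral_exp_mul_Ioi (by simpa using hb), neg_mul, ← div_eq_inv_mul, neg_div]
    field_simp
  rw [← hupper, ← Set.compl_Iic, probReal_compl_eq_one_sub measurableSet_Iic, sub_sub_cancel]

/-- The probability that a vertex of induced degree `d` and threshold `θ` is removed in a round of
the naive loop, that is, the probability that `d + Lap(8 / ε) ≤ θ`. -/
def removalProb (ε d θ : ℝ) : ℝ := (laplace (8 / ε)).real {ν : ℝ | d + ν ≤ θ}

theorem removalProb_eq {ε : ℝ} (hε : 0 < ε) (d θ : ℝ) :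
    removalProb ε d θ = if (θ - d) * ε / 8 ≤ 0 then Real.exp ((θ - d) * ε / 8) / 2
      else 1 - Real.exp (-((θ - d) * ε / 8)) / 2 := by
  have hset : {ν : ℝ | d + ν ≤ θ} = Set.Iic (θ - d) := by
    ext ν
    simp [le_sub_iff_add_le']
  have hscale : (θ - d) / (8 / ε) = (θ - d) * ε / 8 := by field_simp
  have hsign : (θ - d) * ε / 8 ≤ 0 ↔ θ - d ≤ 0 := by
    rw [← not_lt, ← not_lt, mul_div_assoc, mul_pos_iff_of_pos_right (by positivity)]
  have hb : 0 < 8 / ε := by positivity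
  rw [removalProb, hset]
  split_ifs with h
  · rw [laplace_real_Iic_of_nonpos hb (hsign.1 h), hscale]
  · rw [laplace_real_Iic_of_nonneg hb (not_le.1 (mt hsign.2 h)).le, neg_div, hscale]

theorem removalProb_pos {ε : ℝ} (hε : 0 < ε) (d θ : ℝ) : 0 < removalProb ε d θ := by
  rw [removalProb_eq hε]
  split_ifs with h
  · positivity
  · have : Real.exp (-((θ - d) * ε / 8)) ≤ 1 := Real.exp_le_one_iff.2 (by linarith)
    linarith

theorem removalProb_le_one {ε : ℝ} (hε : 0 < ε) (d θ : ℝ) : removalProb ε d θ ≤ 1 := by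
  have := isProbabilityMeasure_laplace (b := 8 / ε) (by positivity)
  exact measureReal_le_one

theorem noisyTest_true {ε : ℝ} (hε : 0 < ε) (d θ : ℝ) :
    noisyTest ε hε d θ true = ENNReal.ofReal (removalProb ε d θ) := by
  have := isProbabilityMeasure_laplace (b := 8 / ε) (by positivity)
  rw [noisyTest, Measure.toPMF_apply, Measure.map_apply (measurable_noisyTest d θ) (by simp),
    removalProb, ofReal_measureReal]
  congr 1
  ext ν
  simp

theorem one_le_of_mem_support_geom {q : ℝ} {g : ℕ} (hg : g ∈ (geom q).support) : 1 ≤ g := by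
  obtain ⟨j, _, rfl⟩ := (PMF.mem_support_map_iff _ _ _).1 hg
  exact Nat.le_add_left 1 j

theorem geom_zero (q : ℝ) : geom q 0 = 0 :=
  (PMF.apply_eq_zero_iff _ _).2 fun h => absurd (one_le_of_mem_support_geom h) (by norm_num)

theorem map_succ_apply_succ (p : PMF ℕ) (j : ℕ) : (p.map (· + 1)) (j + 1) = p j := by
  rw [PMF.map_apply, tsum_eq_single j (by intro i hi; rw [if_neg (by omega)]), if_pos rfl]

theorem geom_succ {q : ℝ} (h0 : 0 < q) (h1 : q ≤ 1) (j : ℕ) :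
    geom q (j + 1) = ENNReal.ofReal ((1 - q) ^ j * q) := by
  have hne : Set.projIcc 0 1 zero_le_one q ≠ 0 := by
    rw [Set.projIcc_of_mem zero_le_one ⟨h0.le, h1⟩]
    exact fun h => h0.ne' (congrArg Subtype.val h)
  rw [geom, map_succ_apply_succ, Measure.toPMF_apply, geometricMeasure_singleton hne,
    Set.projIcc_of_mem zero_le_one ⟨h0.le, h1⟩]

theorem geom_eq_bind {q : ℝ} (h0 : 0 < q) (h1 : q ≤ 1) {p : PMF Bool}
    (hp : p true = ENNReal.ofReal q) :
    geom q = p.bind fun b => if b = true then PMF.pure 1 else (geom q).map (· + 1) := by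
  have hp' : p false = ENNReal.ofReal (1 - q) := by
    have hsum := p.tsum_coe
    rw [tsum_bool, hp] at hsum
    rw [ENNReal.ofReal_sub _ h0.le, ENNReal.ofReal_one, ← hsum,
      ENNReal.add_sub_cancel_right ENNReal.ofReal_ne_top]
  ext j
  rw [PMF.bind_apply, tsum_bool, hp, hp', if_neg Bool.false_ne_true, if_pos rfl]
  rcases j with _ | _ | j
  · simp [geom_zero, PMF.map_apply]
  · simp [geom_succ h0 h1, geom_zero]
  · rw [map_succ_apply_succ, geom_succ h0 h1, geom_succ h0 h1,
      PMF.pure_apply_of_ne _ _ (by omega), mul_zero, add_zero, ← ENNReal.ofReal_mul (by linarith)]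
    ring_nf

/-- The law at time `t` of the round in which a vertex of threshold `θ` is removed by the naive
loop, as long as its induced degree stays equal to `d`. -/
def removalTimeLaw (ε d θ : ℝ) (t : ℕ) : PMF ℕ :=
  (geom (removalProb ε d θ)).map (t + ·)

theorem lt_of_mem_support_removalTimeLaw {ε d θ : ℝ} {t x : ℕ}
    (hx : x ∈ (removalTimeLaw ε d θ t).support) : t < x := by
  obtain ⟨g, hg, rfl⟩ := (PMF.mem_support_map_iff _ _ _).1 hx
  exact Nat.lt_add_of_pos_right (one_le_of_mem_support_geom hg)

theorem removalTimeLaw_eq_bind {ε : ℝ} (hε : 0 < ε) (d θ : ℝ) (t : ℕ) :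
    removalTimeLaw ε d θ t = (noisyTest ε hε d θ).bind fun b =>
      if b = true then PMF.pure (t + 1) else removalTimeLaw ε d θ (t + 1) := by
  rw [removalTimeLaw, geom_eq_bind (removalProb_pos hε d θ) (removalProb_le_one hε d θ)
    (noisyTest_true hε d θ), PMF.map_bind]
  refine congrArg _ (funext fun b => ?_)
  cases b
  · simp only [Bool.false_eq_true, if_false, removalTimeLaw, PMF.map_comp]
    congr 1
    funext g
    simp only [Function.comp_apply]
    ring
  · exact PMF.pure_map _ _

/-! ### Removal times in the naive loop -/

section Naive

variable {n : ℕ} (G : SimpleGraph (Fin n)) (ε : ℝ) (thr : Fin n → ℝ)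

theorem mem_nbrsIn {S : Finset (Fin n)} {v w : Fin n} : w ∈ nbrsIn G S v ↔ w ∈ S ∧ G.Adj v w := by
  simp [nbrsIn]

/-- The vertices of `S` with a neighbour in `R`, that is, the ones whose induced degree changes
when `R` is removed. -/
def exposed (S R : Finset (Fin n)) : Finset (Fin n) :=
  open Classical in S.filter fun w => ∃ v ∈ R, G.Adj v w

theorem mem_exposed {S R : Finset (Fin n)} {w : Fin n} :
    w ∈ exposed G S R ↔ w ∈ S ∧ ∃ v ∈ R, G.Adj v w := by
  simp [exposed]

theorem indDeg_eq_of_notMem_exposed {S R V : Finset (Fin n)} {v : Fin n} (hSV : S ⊆ V)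
    (hV : V ⊆ S ∪ R) (hv : v ∈ S) (hexp : v ∉ exposed G S R) : indDeg G S v = indDeg G V v := by
  refine congrArg Finset.card (Finset.ext fun w => ?_)
  have hwR : w ∈ R → ¬ G.Adj v w := fun hw hadj =>
    hexp ((mem_exposed G).2 ⟨hv, w, hw, hadj.symm⟩)
  have hwS := @hSV w
  have hwV := @hV w
  simp only [mem_nbrsIn, Finset.mem_union] at hwV ⊢
  tauto

/-- The law at time `t` of the round in which the naive loop removes `v`, as long as the current
set stays equal to `V`. -/
def nextRemoval (V : Finset (Fin n)) (t : ℕ) (v : Fin n) : PMF ℕ :=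
  removalTimeLaw ε (indDeg G V v) (thr v) t

/-- The vertices whose removal time is `x`. -/
def due (τ : Fin n → ℕ) (x : ℕ) : Finset (Fin n) := Finset.univ.filter fun v => τ v = x

theorem mem_due {τ : Fin n → ℕ} {x : ℕ} {v : Fin n} : v ∈ due τ x ↔ τ v = x := by simp [due]

theorem foldlM_erase_eq_map_redrawList {ι : Type} [DecidableEq ι] (coin : ι → PMF Bool)
    (V : Finset ι) {l : List ι} (hl : l.Nodup) {b : ι → Bool} (hb : ∀ v ∈ l, b v = false) :
    (l.foldlM (init := V.filter (b · = false)) fun W v => do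
      let b ← coin v
      pure (if b = true then W.erase v else W)) =
    (redrawList coin l b).map fun b => V.filter (b · = false) := by
  induction l generalizing b with
  | nil => exact (PMF.pure_map (fun b : ι → Bool => V.filter (b · = false)) b).symm
  | cons v l ih =>
    obtain ⟨hvl, hl⟩ := List.nodup_cons.1 hl
    rw [List.foldlM_cons, bind_assoc, redrawList, PMF.map_bind]
    refine congrArg _ (funext fun a => ?_)
    rw [← ih hl fun w hw => ?_, pure_bind]
    · have hv := hb v List.mem_cons_self
      congr 1
      ext w
      rcases eq_or_ne w v with rfl | hwv <;> cases a <;> simp [*]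
    · rw [Function.update_of_ne (by rintro rfl; exact hvl hw)]
      exact hb w (List.mem_cons_of_mem v hw)

theorem naiveBody_eq_map_redraw (hε : 0 < ε) (V : Finset (Fin n)) :
    naiveBody G ε hε thr V =
      (redraw (fun v => noisyTest ε hε (indDeg G V v) (thr v)) V fun _ => false).map
        fun b => V.filter (b · = false) := by
  have hfold := foldlM_erase_eq_map_redrawList (fun v => noisyTest ε hε (indDeg G V v) (thr v)) V
    (V.sort_nodup (· ≤ ·)) (b := fun _ => false) fun _ _ => rfl
  rw [redrawList_eq_redraw _ (V.sort_nodup _) fun v => Finset.mem_sort _,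
    Finset.filter_true_of_mem fun _ _ => rfl] at hfold
  exact hfold

theorem subset_of_mem_support_naiveBody (hε : 0 < ε) {V V' : Finset (Fin n)}
    (hV' : V' ∈ (naiveBody G ε hε thr V).support) : V' ⊆ V := by
  rw [naiveBody_eq_map_redraw, PMF.mem_support_map_iff] at hV'
  obtain ⟨b, _, rfl⟩ := hV'
  exact V.filter_subset _

/-- Memorylessness: independent removal times can be drawn by tossing the coins of one round and
drawing the times of the survivors afresh. -/
theorem redraw_nextRemoval_eq_bind_naiveBody (hε : 0 < ε) (V : Finset (Fin n)) (t : ℕ)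
    (τ : Fin n → ℕ) :
    redraw (nextRemoval G ε thr V t) V τ = (naiveBody G ε hε thr V).bind fun V' =>
      redraw (nextRemoval G ε thr V (t + 1)) V' ((V \ V').piecewise (fun _ => t + 1) τ) := by
  rw [redraw_eq_bind_redraw (μ := nextRemoval G ε thr V t)
    (fun v => removalTimeLaw_eq_bind hε (indDeg G V v) (thr v) t) V τ fun _ => false,
    naiveBody_eq_map_redraw, PMF.bind_map]
  refine congrArg _ (funext fun b => ?_)
  have hpure : ∀ v ∈ V \ V.filter (b · = false), (if b v = true then PMF.pure (t + 1)
      else removalTimeLaw ε (indDeg G V v) (thr v) (t + 1)) = PMF.pure (t + 1) := by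
    intro v hv
    simp only [Finset.mem_sdiff, Finset.mem_filter, not_and, Bool.not_eq_false] at hv
    exact if_pos (hv.2 hv.1)
  rw [redraw_eq_redraw_sdiff (y := fun _ => t + 1) Finset.sdiff_subset hpure,
    Finset.sdiff_sdiff_eq_self (V.filter_subset _)]
  exact redraw_congr (fun v hv => if_neg (by simp [(Finset.mem_filter.1 hv).2])) _

theorem due_of_mem_support_redraw {μ : Fin n → PMF ℕ} {S : Finset (Fin n)} {τ τ' : Fin n → ℕ}
    {x : ℕ} (hτ' : τ' ∈ (redraw μ S τ).support) (hx : ∀ v ∈ S, x ∉ (μ v).support) :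
    due τ' x = due τ x \ S := by
  obtain ⟨hkept, hdrawn⟩ := mem_support_redraw hτ'
  ext v
  rw [Finset.mem_sdiff, mem_due, mem_due]
  by_cases hv : v ∈ S
  · simp only [hv, not_true_eq_false, and_false, iff_false]
    rintro rfl
    exact hx v hv (hdrawn v hv)
  · simp only [hkept v hv, hv, not_false_eq_true, and_true]

/-- The observations of `k` more rounds of a loop that removes each vertex at its removal time.
After a round that has removed `R` from `V`, it redraws the removal times of `rule V R`. -/
def lazyRun (rule : Finset (Fin n) → Finset (Fin n) → Finset (Fin n)) :
    ℕ → ℕ → Finset (Fin n) → (Fin n → ℕ) → List (Finset (Fin n)) →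
      PMF (List (Finset (Fin n)) × Bool)
  | 0, _, _, _, tr => PMF.pure (tr, false)
  | k + 1, t, V, τ, tr =>
    let R := due τ (t + 1)
    if V \ (V \ R) = ∅ then PMF.pure (tr ++ [V \ R], true)
    else (redraw (nextRemoval G ε thr (V \ R) (t + 1)) (rule V R) τ).bind fun τ' =>
      lazyRun rule k (t + 1) (V \ R) τ' (tr ++ [V \ R])

variable {rule : Finset (Fin n) → Finset (Fin n) → Finset (Fin n)}

theorem redraw_nextRemoval_bind_redraw {V R U : Finset (Fin n)}
    (hU : exposed G (V \ R) R ⊆ U) (t : ℕ) (τ : Fin n → ℕ) :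
    (redraw (nextRemoval G ε thr V t) (V \ R) τ).bind (redraw (nextRemoval G ε thr (V \ R) t) U) =
      (redraw (nextRemoval G ε thr (V \ R) t) U τ).bind
        (redraw (nextRemoval G ε thr (V \ R) t) (V \ R)) := by
  rw [redraw_bind_redraw fun v hv => ?_, redraw_bind_redraw fun _ _ => rfl, Finset.union_comm]
  obtain ⟨hvV, hvU⟩ := Finset.mem_sdiff.1 hv
  rw [nextRemoval, nextRemoval, indDeg_eq_of_notMem_exposed G Finset.sdiff_subset
    (Finset.sdiff_union_self_eq_union (s := V) ▸ Finset.subset_union_left) hvV fun h => hvU (hU h)]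

/-- Since only exposed vertices change their degrees, a loop that redraws at least these keeps the
removal times of the current vertices independent, each with the law `nextRemoval`. -/
theorem redraw_bind_lazyRun (hε : 0 < ε) (hrule : ∀ V R, exposed G (V \ R) R ⊆ rule V R)
    (k t : ℕ) (V : Finset (Fin n)) (τ : Fin n → ℕ) (tr : List (Finset (Fin n))) :
    ((redraw (nextRemoval G ε thr V t) V τ).bind fun τ' => lazyRun G ε thr rule k t V τ' tr) =
      (loopFrom (naiveBody G ε hε thr) id k ⟨V, tr, false⟩).map LoopCfg.observe := by
  induction k generalizing t V τ tr with
  | zero => simp only [lazyRun, PMF.bind_const, loopFrom, PMF.pure_map, LoopCfg.observe]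
  | succ k ih =>
    rw [redraw_nextRemoval_eq_bind_naiveBody G ε thr hε, PMF.bind_bind, loopFrom_succ,
      PMF.map_bind]
    refine pmf_bind_congr _ fun V' hV' => ?_
    have hsub := subset_of_mem_support_naiveBody G ε thr hε hV'
    set τ₀ : Fin n → ℕ := (V \ V').piecewise (fun _ => t + 1) τ with hτ₀
    obtain ⟨R, hR⟩ : ∃ R, R = due τ₀ (t + 1) \ V' := ⟨_, rfl⟩
    obtain rfl : V \ R = V' := by
      ext v
      by_cases hv : v ∈ V'
      · simp [hR, hv, hsub hv]
      · simp +contextual [hR, hτ₀, mem_due, Finset.piecewise, hv]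
    rw [pmf_bind_congr (g := fun τ₁ => if V \ (V \ R) = ∅ then PMF.pure (tr ++ [V \ R], true)
        else (redraw (nextRemoval G ε thr (V \ R) (t + 1)) (rule V R) τ₁).bind fun τ' =>
          lazyRun G ε thr rule k (t + 1) (V \ R) τ' (tr ++ [V \ R])) _ fun τ₁ hτ₁ => ?_]
    · simp only [id]
      split_ifs with hdone
      · rw [PMF.bind_const, loopFrom_of_done _ (by simpa using hdone), PMF.pure_map]
        simp only [LoopCfg.observe, hdone, decide_true]
      · rw [← PMF.bind_bind, redraw_nextRemoval_bind_redraw G ε thr (hrule V R), PMF.bind_bind]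
        simp only [ih, PMF.bind_const, hdone, decide_false]
    · rw [lazyRun, due_of_mem_support_redraw hτ₁ fun v _ hv =>
        (lt_of_mem_support_removalTimeLaw hv).false, ← hR]

end Naive

/-! ### The resampling loop -/

section Resampling

variable {n : ℕ} (G : SimpleGraph (Fin n)) (ε : ℝ) (thr : Fin n → ℝ)

/-- The buckets `toRemove x` of all future rounds `x` agree with the removal times, except that
they may lack vertices of `D`. -/
def EffState.Synced (s : EffState n) (D : Finset (Fin n)) : Prop :=
  ∀ v x, s.t < x →
    (v ∈ s.toRemove x → s.removeTime v = x) ∧ (v ∉ D → s.removeTime v = x → v ∈ s.toRemove x)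

theorem EffState.synced_start : (EffState.start n).Synced (EffState.start n).updated :=
  fun v _ _ => ⟨fun h => absurd h (Finset.notMem_empty v), fun h => absurd (Finset.mem_univ v) h⟩

/-- Move `v` to the bucket of round `x`, at the cost of one resampling. -/
def EffState.moveTo (s : EffState n) (v : Fin n) (x : ℕ) : EffState n :=
  let old := Function.update s.toRemove (s.removeTime v) ((s.toRemove (s.removeTime v)).erase v)
  { s with
    toRemove := Function.update old x (insert v (old x))
    removeTime := Function.update s.removeTime v x
    work := s.work + 1 }

theorem EffState.mem_toRemove_moveTo_of_ne (s : EffState n) {v w : Fin n} (hwv : w ≠ v)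
    (x y : ℕ) : w ∈ (s.moveTo v x).toRemove y ↔ w ∈ s.toRemove y := by
  simp only [moveTo, Function.update_apply]
  split_ifs <;> simp_all

theorem EffState.Synced.mem_toRemove_moveTo_self {s : EffState n} {D : Finset (Fin n)}
    (h : s.Synced D) (v : Fin n) (x : ℕ) {y : ℕ} (hy : s.t < y) :
    v ∈ (s.moveTo v x).toRemove y ↔ y = x := by
  simp only [moveTo, Function.update_apply]
  rcases eq_or_ne y x with rfl | hyx
  · simp
  · rcases eq_or_ne y (s.removeTime v) with rfl | hyv
    · simp [hyx]
    · simpa [hyx, hyv] using fun hv => hyv ((h v y hy).1 hv).symm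

theorem EffState.Synced.moveTo {s : EffState n} {v : Fin n} {D D' : Finset (Fin n)}
    (h : s.Synced D) (hD : D ⊆ insert v D') (x : ℕ) : (s.moveTo v x).Synced D' := by
  intro w y hy
  rcases eq_or_ne w v with rfl | hwv
  · rw [h.mem_toRemove_moveTo_self w x hy]
    simp [EffState.moveTo, eq_comm]
  · have hw := h w y hy
    rw [s.mem_toRemove_moveTo_of_ne hwv]
    simp only [EffState.moveTo, Function.update_of_ne hwv]
    exact ⟨hw.1, fun hwD' => hw.2 fun hwD =>
      hwD' ((Finset.mem_insert.1 (hD hwD)).resolve_left hwv)⟩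

theorem resample_eq_map_moveTo (s : EffState n) (v : Fin n) :
    resample G ε thr s v = (nextRemoval G ε thr s.V s.t v).map (s.moveTo v) := by
  rw [nextRemoval, removalTimeLaw, PMF.map_comp]
  rfl

theorem foldlM_resample_cons (s : EffState n) (v : Fin n) (l : List (Fin n)) :
    (v :: l).foldlM (resample G ε thr) s = (nextRemoval G ε thr s.V s.t v).bind fun x =>
      l.foldlM (resample G ε thr) (s.moveTo v x) := by
  rw [List.foldlM_cons, resample_eq_map_moveTo]
  exact PMF.bind_map _ _ _

theorem map_removeTime_foldlM_resample (l : List (Fin n)) (s : EffState n) :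
    (l.foldlM (resample G ε thr) s).map EffState.removeTime =
      redrawList (nextRemoval G ε thr s.V s.t) l s.removeTime := by
  induction l generalizing s with
  | nil => exact PMF.pure_map _ _
  | cons v l ih =>
    rw [foldlM_resample_cons, PMF.map_bind]
    simp only [ih]
    rfl

/-- What is known of the state `s'` that results from resampling the vertices of `l` in the
state `s`. -/
structure EffState.Resampled (s : EffState n) (l : List (Fin n)) (s' : EffState n) : Prop where
  t_eq : s'.t = s.t
  V_eq : s'.V = s.V
  work_eq : s'.work = s.work + l.length
  removeTime_eq : ∀ v ∉ l, s'.removeTime v = s.removeTime v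
  synced : s'.Synced ∅

theorem resampled_of_mem_support {l : List (Fin n)} {s s' : EffState n}
    (hs : s.Synced l.toFinset) (hs' : s' ∈ (l.foldlM (resample G ε thr) s).support) :
    s.Resampled l s' := by
  induction l generalizing s with
  | nil =>
    obtain rfl := (PMF.mem_support_pure_iff s s').1 hs'
    exact ⟨rfl, rfl, rfl, fun _ _ => rfl, hs⟩
  | cons v l ih =>
    rw [foldlM_resample_cons, PMF.mem_support_bind_iff] at hs'
    obtain ⟨x, _, hs'⟩ := hs'
    have h := ih (hs.moveTo (List.toFinset_cons (a := v)).subset x) hs'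
    refine ⟨h.t_eq, h.V_eq, ?_, fun w hw => ?_, h.synced⟩
    · rw [h.work_eq, List.length_cons, EffState.moveTo]
      ring
    · obtain ⟨hwv, hwl⟩ := not_or.1 (mt List.mem_cons.2 hw)
      rw [h.removeTime_eq w hwl]
      exact Function.update_of_ne hwv _ _

/-- The set `updated` after the vertices of a list have been removed in turn, starting from the
vertices `V` and the value `U` of `updated`. -/
def touched : List (Fin n) → Finset (Fin n) → Finset (Fin n) → Finset (Fin n)
  | [], _, U => U
  | v :: r, V, U => touched r (V.erase v) (U ∪ nbrsIn G (V.erase v) v)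

theorem subset_touched (r : List (Fin n)) (V U : Finset (Fin n)) : U ⊆ touched G r V U := by
  induction r generalizing V U with
  | nil => exact subset_rfl
  | cons v r ih => exact Finset.subset_union_left.trans (ih _ _)

theorem touched_subset (r : List (Fin n)) (V U : Finset (Fin n)) : touched G r V U ⊆ U ∪ V := by
  induction r generalizing V U with
  | nil => exact Finset.subset_union_left
  | cons v r ih =>
    intro w hw
    have := ih _ _ hw
    simp only [Finset.mem_union, mem_nbrsIn, Finset.mem_erase] at this ⊢
    tauto

theorem exposed_subset_touched (V R : Finset (Fin n)) :
    exposed G (V \ R) R ⊆ touched G (R.sort (· ≤ ·)) V ∅ := by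
  have hmem : ∀ (r : List (Fin n)) (V U : Finset (Fin n)) {v w : Fin n}, v ∈ r → w ∈ V → w ∉ r →
      G.Adj v w → w ∈ touched G r V U := by
    intro r
    induction r with
    | nil => simp
    | cons u r ih =>
      intro V U v w hv hw hwr hadj
      obtain ⟨hwu, hwr⟩ := not_or.1 (mt List.mem_cons.2 hwr)
      have hw' : w ∈ V.erase u := Finset.mem_erase.2 ⟨hwu, hw⟩
      rcases List.mem_cons.1 hv with rfl | hv
      · rw [touched]
        exact subset_touched G _ _ _ <| Finset.mem_union_right _ <| (mem_nbrsIn G).2 ⟨hw', hadj⟩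
      · exact ih _ _ hv hw' hwr hadj
  intro w hw
  obtain ⟨hwV, v, hv, hadj⟩ := (mem_exposed G).1 hw
  obtain ⟨hwV, hwR⟩ := Finset.mem_sdiff.1 hwV
  exact hmem _ _ _ ((Finset.mem_sort _).2 hv) hwV (mt (Finset.mem_sort _).1 hwR) hadj

theorem card_touched_le (r : List (Fin n)) (V U : Finset (Fin n)) :
    (touched G r V U).card ≤ U.card + (r.map (indDeg G Finset.univ)).sum := by
  induction r generalizing V U with
  | nil => simp [touched]
  | cons v r ih =>
    have hunion := Finset.card_union_le U (nbrsIn G (V.erase v) v)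
    have hdeg : (nbrsIn G (V.erase v) v).card ≤ indDeg G Finset.univ v :=
      Finset.card_le_card fun w hw =>
        (mem_nbrsIn G).2 ⟨Finset.mem_univ w, ((mem_nbrsIn G).1 hw).2⟩
    have := ih (V.erase v) (U ∪ nbrsIn G (V.erase v) v)
    simp only [touched, List.map_cons, List.sum_cons]
    omega

theorem foldl_removeVertex (r : List (Fin n)) (s : EffState n) :
    r.foldl (removeVertex G) s = { s with
      V := s.V \ r.toFinset
      updated := touched G r s.V s.updated
      work := s.work + (r.map fun v => 1 + indDeg G Finset.univ v).sum } := by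
  induction r generalizing s with
  | nil => simp [touched]
  | cons v r ih =>
    rw [List.foldl_cons, ih]
    simp only [removeVertex, touched, List.map_cons, List.sum_cons, EffState.mk.injEq, true_and]
    refine ⟨?_, by ring⟩
    ext w
    simp only [List.toFinset_cons, Finset.mem_sdiff, Finset.mem_erase, Finset.mem_insert]
    tauto

theorem sum_map_sort (S : Finset (Fin n)) (f : Fin n → ℕ) :
    ((S.sort (· ≤ ·)).map f).sum = ∑ v ∈ S, f v := by
  rw [((Finset.sort_perm_toList S _).map f).sum_eq, Finset.sum_map_toList]

/-- The second half of a round: time advances and the vertices that are due are removed. -/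
def finishRound (s : EffState n) : EffState n :=
  let s₂ : EffState n := { s with t := s.t + 1, updated := ∅, work := s.work + 1 }
  ((s₂.toRemove s₂.t).sort (· ≤ ·)).foldl (removeVertex G) s₂

theorem effBody_eq_map_finishRound (s : EffState n) :
    effBody G ε thr s =
      ((s.updated.sort (· ≤ ·)).foldlM (resample G ε thr) s).map (finishRound G) :=
  rfl

theorem EffState.Synced.toRemove_succ {s : EffState n} (h : s.Synced ∅) :
    s.toRemove (s.t + 1) = due s.removeTime (s.t + 1) := by
  ext v
  have hv := h v (s.t + 1) (Nat.lt_succ_self _)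
  rw [mem_due]
  exact ⟨hv.1, hv.2 (Finset.notMem_empty v)⟩

theorem finishRound_eq {s : EffState n} (h : s.Synced ∅) :
    finishRound G s = { s with
      t := s.t + 1
      V := s.V \ due s.removeTime (s.t + 1)
      updated := touched G ((due s.removeTime (s.t + 1)).sort (· ≤ ·)) s.V ∅
      work := s.work + 1 +
        ∑ v ∈ due s.removeTime (s.t + 1), (1 + indDeg G Finset.univ v) } := by
  rw [finishRound, foldl_removeVertex]
  simp only [h.toRemove_succ, Finset.sort_toFinset, sum_map_sort]

theorem EffState.Synced.finishRound {s : EffState n} (h : s.Synced ∅) (D : Finset (Fin n)) :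
    (finishRound G s).Synced D := by
  rw [finishRound_eq G h]
  intro v x hx
  have hv := h v x (Nat.lt_of_succ_lt hx)
  exact ⟨hv.1, fun _ => hv.2 (Finset.notMem_empty v)⟩

theorem map_observe_loopFrom_effBody (k : ℕ) (s : EffState n) (hs : s.Synced s.updated)
    (tr : List (Finset (Fin n))) :
    (loopFrom (effBody G ε thr) EffState.V k ⟨s, tr, false⟩).map LoopCfg.observe =
      (redraw (nextRemoval G ε thr s.V s.t) s.updated s.removeTime).bind fun τ =>
        lazyRun G ε thr (fun V R => touched G (R.sort (· ≤ ·)) V ∅) k s.t s.V τ tr := by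
  induction k generalizing s tr with
  | zero => simp only [loopFrom, PMF.pure_map, lazyRun, PMF.bind_const, LoopCfg.observe]
  | succ k ih =>
    rw [loopFrom_succ, effBody_eq_map_finishRound, PMF.bind_map, PMF.map_bind,
      ← redrawList_eq_redraw _ (s.updated.sort_nodup (· ≤ ·)) fun v => Finset.mem_sort _,
      ← map_removeTime_foldlM_resample, PMF.bind_map]
    refine pmf_bind_congr _ fun s₁ hs₁ => ?_
    have h := resampled_of_mem_support G ε thr (by simpa using hs) hs₁
    have hstep := finishRound_eq G h.synced
    simp only [h.t_eq, h.V_eq] at hstep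
    simp only [Function.comp_apply, lazyRun]
    rw [show (finishRound G s₁).V = _ from congrArg EffState.V hstep]
    split_ifs with hdone
    · rw [loopFrom_of_done _ (by simpa using hdone), PMF.pure_map]
      simp only [LoopCfg.observe, hdone, decide_true]
    · simp only [hdone, decide_false]
      rw [ih _ (h.synced.finishRound G _), hstep]

theorem map_observe_effRun (hε : 0 < ε) (k : ℕ) :
    (effRun G ε thr k).map LoopCfg.observe = (naiveRun G ε hε thr k).map LoopCfg.observe := by
  rw [effRun, naiveRun, loopRun_eq_loopFrom, loopRun_eq_loopFrom,
    map_observe_loopFrom_effBody G ε thr k _ EffState.synced_start]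
  exact redraw_bind_lazyRun G ε thr hε (exposed_subset_touched G) k 0 Finset.univ _ [Finset.univ]

theorem map_V_effRun (hε : 0 < ε) (k : ℕ) :
    (effRun G ε thr k).map (fun c => c.state.V) =
      (naiveRun G ε hε thr k).map fun c => c.state := by
  have hnaive := map_cur_loopRun (body := naiveBody G ε hε thr) (cur := id) Finset.univ k
  rw [effRun, map_cur_loopRun, ← effRun, map_observe_effRun G ε thr hε]
  exact hnaive.symm

theorem done_of_mem_support_naiveRun (hε : 0 < ε) :
    ∀ c ∈ (naiveRun G ε hε thr (n + 1)).support, c.done = true :=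
  done_of_mem_support_loopRun (fun _ _ => subset_of_mem_support_naiveBody G ε thr hε) _

theorem done_of_mem_support_effRun (hε : 0 < ε) :
    ∀ c ∈ (effRun G ε thr (n + 1)).support, c.done = true := by
  intro c hc
  have hobs : c.observe ∈ ((effRun G ε thr (n + 1)).map LoopCfg.observe).support :=
    (PMF.mem_support_map_iff _ _ _).2 ⟨c, hc, rfl⟩
  rw [map_observe_effRun G ε thr hε, PMF.mem_support_map_iff] at hobs
  obtain ⟨c', hc', hobs_eq⟩ := hobs
  rw [← done_of_mem_support_naiveRun G ε thr hε c' hc']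
  exact congrArg Prod.snd hobs_eq.symm

/-! ### The work of the resampling loop -/

/-- How many more times `v` can be taken from a bucket. A vertex that is removed and exposed in
the same round is removed once more later on, without effect. -/
def EffState.credit (s : EffState n) (v : Fin n) : ℕ :=
  if v ∈ s.V then 2 else if v ∈ s.updated ∨ s.t < s.removeTime v then 1 else 0

/-- A bound on the total work, apart from the number of rounds to come: the work done, the
pending resamplings, and for each future removal of a vertex its cost and the resamplings it can
cause. -/
def EffState.potential (s : EffState n) : ℕ :=
  s.work + s.updated.card + ∑ v, s.credit v * (1 + 2 * indDeg G Finset.univ v)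

section Round

variable {s s₁ : EffState n}

theorem EffState.Resampled.credit_finishRound_le
    (h : s.Resampled (s.updated.sort (· ≤ ·)) s₁) (v : Fin n) :
    (finishRound G s₁).credit v + (if v ∈ due s₁.removeTime (s₁.t + 1) then 1 else 0) ≤
      s.credit v := by
  have htouched := @touched_subset n G ((due s₁.removeTime (s₁.t + 1)).sort (· ≤ ·)) s₁.V ∅ v
  have htime := h.removeTime_eq v
  rw [Finset.empty_union] at htouched
  rw [Finset.mem_sort] at htime
  rw [finishRound_eq G h.synced]
  simp only [EffState.credit, mem_due, Finset.mem_sdiff]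
  rw [h.V_eq, h.t_eq] at *
  by_cases hV : v ∈ s.V
  · simp only [hV, true_and, if_true]
    split_ifs <;> omega
  · simp only [hV, false_and, if_false, mt htouched hV, false_or]
    by_cases hU : v ∈ s.updated
    · simp only [hU, true_or, if_true]
      split_ifs <;> omega
    · rw [htime hU]
      simp only [hU, false_or]
      split_ifs <;> omega

theorem EffState.Resampled.sum_credit_finishRound_le
    (h : s.Resampled (s.updated.sort (· ≤ ·)) s₁) (f : Fin n → ℕ) :
    ∑ v, (finishRound G s₁).credit v * f v + ∑ v ∈ due s₁.removeTime (s₁.t + 1), f v ≤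
      ∑ v, s.credit v * f v := by
  rw [← Finset.univ_inter (due _ _), ← Finset.sum_ite_mem, ← Finset.sum_add_distrib]
  refine Finset.sum_le_sum fun v _ => ?_
  have := Nat.mul_le_mul_right (f v) (h.credit_finishRound_le G v)
  rwa [add_mul, ite_mul, one_mul, zero_mul] at this

theorem EffState.Resampled.potential_finishRound_le
    (h : s.Resampled (s.updated.sort (· ≤ ·)) s₁) :
    (finishRound G s₁).potential G ≤ s.potential G + 1 := by
  have hcredit := h.sum_credit_finishRound_le G fun v => 1 + 2 * indDeg G Finset.univ v
  have hwork : (finishRound G s₁).work = s.work + s.updated.card + 1 +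
      ∑ v ∈ due s₁.removeTime (s₁.t + 1), (1 + indDeg G Finset.univ v) := by
    rw [finishRound_eq G h.synced]
    simp only [h.work_eq, Finset.length_sort]
  have hupdated : (finishRound G s₁).updated.card ≤
      ∑ v ∈ due s₁.removeTime (s₁.t + 1), indDeg G Finset.univ v := by
    rw [finishRound_eq G h.synced]
    simpa only [sum_map_sort, Finset.card_empty, zero_add] using
      card_touched_le G ((due s₁.removeTime (s₁.t + 1)).sort (· ≤ ·)) s₁.V ∅
  have hsplit : ∑ v ∈ due s₁.removeTime (s₁.t + 1), (1 + 2 * indDeg G Finset.univ v) =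
      ∑ v ∈ due s₁.removeTime (s₁.t + 1), (1 + indDeg G Finset.univ v) +
        ∑ v ∈ due s₁.removeTime (s₁.t + 1), indDeg G Finset.univ v := by
    rw [← Finset.sum_add_distrib]
    exact Finset.sum_congr rfl fun v _ => by ring
  simp only [EffState.potential]
  omega

end Round

theorem potential_le_of_mem_support_effRun (k : ℕ) :
    ∀ c ∈ (effRun G ε thr k).support,
      c.state.Synced c.state.updated ∧
        c.state.potential G ≤ (EffState.start n).potential G + k := by
  refine loopRun_induction (P := fun k (c : LoopCfg (EffState n) n) =>
    c.state.Synced c.state.updated ∧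
      c.state.potential G ≤ (EffState.start n).potential G + k) ⟨EffState.synced_start, le_rfl⟩
    (fun k c _ h => ⟨h.1, h.2.trans (Nat.le_succ _)⟩) (fun k c _ h s hs => ?_) k
  rw [effBody_eq_map_finishRound, PMF.mem_support_map_iff] at hs
  obtain ⟨s₁, hs₁, rfl⟩ := hs
  have hres := resampled_of_mem_support G ε thr (by simpa using h.1) hs₁
  exact ⟨hres.synced.finishRound G _, (hres.potential_finishRound_le G).trans
    (Nat.succ_le_succ h.2)⟩

theorem sum_indDeg_univ : ∑ v, indDeg G Finset.univ v = 2 * G.edgeSet.ncard := by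
  classical
  rw [Set.ncard_eq_toFinset_card', ← SimpleGraph.edgeFinset, ← G.sum_degrees_eq_twice_card_edges]
  refine Finset.sum_congr rfl fun v _ => congrArg Finset.card (Finset.ext fun w => ?_)
  rw [mem_nbrsIn, SimpleGraph.mem_neighborFinset]
  exact and_iff_right (Finset.mem_univ w)

theorem potential_start :
    (EffState.start n).potential G = 3 * n + 8 * G.edgeSet.ncard := by
  have hcredit (v : Fin n) : (EffState.start n).credit v = 2 := if_pos (Finset.mem_univ v)
  simp only [EffState.potential, hcredit, ← Finset.mul_sum, Finset.sum_add_distrib,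
    sum_indDeg_univ]
  simp only [EffState.start, Finset.card_univ, Fintype.card_fin, Finset.sum_const, smul_eq_mul]
  ring

theorem work_le_of_mem_support_effRun :
    ∀ c ∈ (effRun G ε thr (n + 1)).support, c.state.work ≤ 8 * (n + G.edgeSet.ncard + 1) := by
  intro c hc
  have h := (potential_le_of_mem_support_effRun G ε thr (n + 1) c hc).2
  rw [potential_start, EffState.potential] at h
  omega

end Resampling

/-! ### Reasoning about programs -/

section Logic

variable {n : ℕ} {K : List Cmd} {σ : Store} {B : ℕ}
  {ν : PMF (Option (List (Finset (Fin n))))}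

/-- From the configuration `p`, the machine halts within `B` steps, with an output of law `ν`. The
rules below run a program forwards: what its continuation outputs determines what it outputs. -/
def Outputs (n : ℕ) (p : List Cmd × Store) (B : ℕ)
    (ν : PMF (Option (List (Finset (Fin n))))) : Prop :=
  ∀ T, B ≤ T → (runFor p T).map (outputTrace n) = ν

theorem runFor_succ_first (p : List Cmd × Store) (T : ℕ) :
    runFor p (T + 1) = (step p).bind fun p' => runFor p' T := by
  induction T with
  | zero => exact (PMF.pure_bind _ _).trans (PMF.bind_pure _).symm
  | succ T ih =>
    change (runFor p (T + 1)).bind step = (step p).bind fun p' => (runFor p' T).bind step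
    rw [ih, PMF.bind_bind]

theorem Outputs.mono {p : List Cmd × Store} {B' : ℕ} (h : Outputs n p B ν) (hB : B ≤ B') :
    Outputs n p B' ν :=
  fun T hT => h T (hB.trans hT)

theorem Outputs.bind {p : List Cmd × Store} {α : Type} {law : PMF α} {next : α → List Cmd × Store}
    {ν : α → PMF (Option (List (Finset (Fin n))))} (hp : step p = law.map next)
    (h : ∀ a ∈ law.support, Outputs n (next a) B (ν a)) : Outputs n p (B + 1) (law.bind ν) := by
  intro T hT
  obtain ⟨T, rfl⟩ : ∃ T', T = T' + 1 := ⟨T - 1, by omega⟩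
  rw [runFor_succ_first, hp, PMF.bind_map, PMF.map_bind]
  exact pmf_bind_congr _ fun a ha => h a ha T (by omega)

theorem Outputs.step {p p' : List Cmd × Store} (hp : step p = PMF.pure p')
    (h : Outputs n p' B ν) : Outputs n p (B + 1) ν := by
  have hstep : Peeling.step p = (PMF.pure p').map id := by rw [hp, PMF.pure_map, id]
  simpa only [PMF.pure_bind] using Outputs.bind (ν := fun _ => ν) hstep fun q hq => by
    rwa [(PMF.mem_support_pure_iff p' q).1 hq]

theorem runFor_halted (σ : Store) (T : ℕ) : runFor ([], σ) T = PMF.pure ([], σ) := by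
  induction T with
  | zero => rfl
  | succ T ih => exact (runFor_succ_first _ T).trans ((PMF.pure_bind _ _).trans ih)

theorem Outputs.halt (B : ℕ) (σ : Store) :
    Outputs n ([], σ) B (PMF.pure (outputTrace n ([], σ))) :=
  fun T _ => by rw [runFor_halted, PMF.pure_map]

theorem Outputs.skip (h : Outputs n (K, σ) B ν) : Outputs n (.skip :: K, σ) (B + 1) ν :=
  h.step rfl

theorem Outputs.setNat {x : ℕ} {e : NExp} (h : Outputs n (K, σ.setNat x (e.eval σ)) B ν) :
    Outputs n (.setNat x e :: K, σ) (B + 1) ν :=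
  h.step rfl

theorem Outputs.putNat {a : ℕ} {i e : NExp}
    (h : Outputs n (K, σ.putNat a (i.eval σ) (e.eval σ)) B ν) :
    Outputs n (.putNat a i e :: K, σ) (B + 1) ν :=
  h.step rfl

theorem Outputs.setReal {x : ℕ} {e : RExp} (h : Outputs n (K, σ.setReal x (e.eval σ)) B ν) :
    Outputs n (.setReal x e :: K, σ) (B + 1) ν :=
  h.step rfl

theorem Outputs.seq {c d : Cmd} (h : Outputs n (c :: d :: K, σ) B ν) :
    Outputs n (.seq c d :: K, σ) (B + 1) ν :=
  h.step rfl

theorem Outputs.ite {b : BExp} {c d : Cmd} (hc : b.holds σ → Outputs n (c :: K, σ) B ν)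
    (hd : ¬ b.holds σ → Outputs n (d :: K, σ) B ν) :
    Outputs n (.ite b c d :: K, σ) (B + 1) ν := by
  by_cases hb : b.holds σ
  · exact (hc hb).step (by rw [Peeling.step, if_pos hb]; rfl)
  · exact (hd hb).step (by rw [Peeling.step, if_neg hb]; rfl)

theorem Outputs.while_true {b : BExp} {c : Cmd} (hb : b.holds σ)
    (h : Outputs n (c :: .while b c :: K, σ) B ν) :
    Outputs n (.while b c :: K, σ) (B + 1) ν :=
  h.step (by rw [Peeling.step, if_pos hb]; rfl)

theorem Outputs.while_false {b : BExp} {c : Cmd} (hb : ¬ b.holds σ) (h : Outputs n (K, σ) B ν) :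
    Outputs n (.while b c :: K, σ) (B + 1) ν :=
  h.step (by rw [Peeling.step, if_neg hb]; rfl)

theorem Outputs.sampleGeom {x : ℕ} {q : RExp} {ν : ℕ → PMF (Option (List (Finset (Fin n))))}
    (h : ∀ g ∈ (geom (q.eval σ)).support, Outputs n (K, σ.setNat x g) B (ν g)) :
    Outputs n (.sampleGeom x q :: K, σ) (B + 1) ((geom (q.eval σ)).bind ν) :=
  Outputs.bind rfl h

end Logic

/-! ### The program

The buckets are linked lists of nodes, numbered from `1`, with `0` as the end of a list. A node is
never deleted: when it comes up, it is ignored unless it agrees with the removal time of its vertex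
and that vertex has not been removed yet. -/

section Program

@[simp] abbrev regSize : ℕ := 0
@[simp] abbrev regRound : ℕ := 1
/-- The vertex being removed. -/
@[simp] abbrev regVertex : ℕ := 2
/-- The current node of the bucket of the round. -/
@[simp] abbrev regNode : ℕ := 3
/-- A position in an adjacency list. -/
@[simp] abbrev regPos : ℕ := 4
/-- The vertex whose removal time is being drawn. -/
@[simp] abbrev regTarget : ℕ := 5
@[simp] abbrev regTime : ℕ := 6
/-- The number of nodes. -/
@[simp] abbrev regNodes : ℕ := 7
/-- Whether a vertex has been removed in this round. -/
@[simp] abbrev regFlag : ℕ := 8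

@[simp] abbrev arrStart : ℕ := 0
@[simp] abbrev arrAdj : ℕ := 1
/-- The rounds in which the vertices were removed. -/
@[simp] abbrev arrRemoved : ℕ := 2
/-- The rounds in which the vertices are to be removed. -/
@[simp] abbrev arrTime : ℕ := 3
@[simp] abbrev arrDeg : ℕ := 4
/-- The first node of each bucket. -/
@[simp] abbrev arrFirst : ℕ := 5
/-- The successor of each node in its bucket. -/
@[simp] abbrev arrNext : ℕ := 6
/-- The vertex of each node. -/
@[simp] abbrev arrVertex : ℕ := 7

@[simp] abbrev realRegEps : ℕ := 0
@[simp] abbrev realRegArg : ℕ := 1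
@[simp] abbrev realRegProb : ℕ := 2
@[simp] abbrev realArrThr : ℕ := 0

/-- Compute the removal probability of the target. -/
def probCmd : Cmd :=
  .seq (.setReal realRegArg (.div (.mul (.sub (.get realArrThr (.reg regTarget))
    (.ofNat (.get arrDeg (.reg regTarget)))) (.reg realRegEps)) (.ofNat (.const 8)))) <|
  .ite (.realLe (.reg realRegArg) (.ofNat (.const 0)))
    (.setReal realRegProb (.div (.exp (.reg realRegArg)) (.ofNat (.const 2))))
    (.setReal realRegProb (.sub (.ofNat (.const 1))
      (.div (.exp (.sub (.ofNat (.const 0)) (.reg realRegArg))) (.ofNat (.const 2)))))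

/-- Draw a new removal time for the target, and put a new node into the bucket of that time. -/
def scheduleCmd : Cmd :=
  .seq probCmd <|
  .seq (.sampleGeom regTime (.reg realRegProb)) <|
  .seq (.setNat regTime (.add (.reg regRound) (.reg regTime))) <|
  .seq (.putNat arrTime (.reg regTarget) (.reg regTime)) <|
  .seq (.setNat regNodes (.add (.reg regNodes) (.const 1))) <|
  .seq (.putNat arrVertex (.reg regNodes) (.reg regTarget)) <|
  .seq (.putNat arrNext (.reg regNodes) (.get arrFirst (.reg regTime))) <|
  .putNat arrFirst (.reg regTime) (.reg regNodes)

def initBody : Cmd :=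
  .seq (.putNat arrDeg (.reg regTarget)
    (.sub (.get arrStart (.add (.reg regTarget) (.const 1))) (.get arrStart (.reg regTarget)))) <|
  .seq scheduleCmd <|
  .setNat regTarget (.add (.reg regTarget) (.const 1))

def initLoop : Cmd := .while (.not (.natLe (.reg regSize) (.reg regTarget))) initBody

/-- Update the target, unless it is due or has been removed. -/
def updateCmd : Cmd :=
  .ite (.natLe (.get arrTime (.reg regTarget)) (.reg regRound)) .skip <|
    .seq (.putNat arrDeg (.reg regTarget) (.sub (.get arrDeg (.reg regTarget)) (.const 1)))
      scheduleCmd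

def scanBody : Cmd :=
  .seq (.setNat regTarget (.get arrAdj (.reg regPos))) <|
  .seq updateCmd <|
  .setNat regPos (.add (.reg regPos) (.const 1))

/-- Update all neighbours of the vertex being removed. -/
def scanLoop : Cmd :=
  .while (.not (.natLe (.get arrStart (.add (.reg regVertex) (.const 1))) (.reg regPos))) scanBody

def visitCmd : Cmd :=
  .seq (.putNat arrRemoved (.reg regVertex) (.reg regRound)) <|
  .seq (.setNat regFlag (.const 1)) <|
  .seq (.setNat regPos (.get arrStart (.reg regVertex))) scanLoop

/-- The vertex of the current node is due and has not been removed. -/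
def visitTest : BExp :=
  .and (.and (.natLe (.get arrTime (.reg regVertex)) (.reg regRound))
    (.natLe (.reg regRound) (.get arrTime (.reg regVertex))))
    (.natLe (.get arrRemoved (.reg regVertex)) (.const 0))

def bucketBody : Cmd :=
  .seq (.setNat regVertex (.get arrVertex (.reg regNode))) <|
  .seq (.ite visitTest visitCmd .skip) <|
  .setNat regNode (.get arrNext (.reg regNode))

/-- Remove the vertices that are due in this round. -/
def bucketLoop : Cmd := .while (.natLe (.const 1) (.reg regNode)) bucketBody

def roundBody : Cmd :=
  .seq (.setNat regFlag (.const 0)) <|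
  .seq (.setNat regRound (.add (.reg regRound) (.const 1))) <|
  .seq (.setNat regNode (.get arrFirst (.reg regRound))) bucketLoop

def mainLoop : Cmd := .while (.natLe (.const 1) (.reg regFlag)) roundBody

def program : Cmd := .seq initLoop (.seq (.setNat regFlag (.const 1)) mainLoop)

end Program

/-! ### The memory of the program -/

section Memory

variable {n : ℕ}

/-- The first node of bucket `x`, if the entries `H` have been put into buckets, the latest
entry first. -/
def firstNode (x : ℕ) : List (ℕ × Fin n) → ℕ
  | [] => 0
  | e :: H => if e.1 = x then H.length + 1 else firstNode x H

/-- The entries `H`, the latest one first, are stored as linked lists. -/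
def NodesOk (next vert : ℕ → ℕ) : List (ℕ × Fin n) → Prop
  | [] => True
  | e :: H => vert (H.length + 1) = e.2 ∧ next (H.length + 1) = firstNode e.1 H ∧
      NodesOk next vert H

theorem NodesOk.congr {next vert next' vert' : ℕ → ℕ} {H : List (ℕ × Fin n)}
    (h : NodesOk next vert H) (hn : ∀ i ≤ H.length, next' i = next i)
    (hv : ∀ i ≤ H.length, vert' i = vert i) : NodesOk next' vert' H := by
  induction H with
  | nil => trivial
  | cons e H ih =>
    exact ⟨(hv _ le_rfl).trans h.1, (hn _ le_rfl).trans h.2.1,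
      ih h.2.2 (fun i hi => hn i (Nat.le_succ_of_le hi)) fun i hi => hv i (Nat.le_succ_of_le hi)⟩

theorem NodesOk.of_suffix {next vert : ℕ → ℕ} {H Q : List (ℕ × Fin n)}
    (h : NodesOk next vert H) (hQ : Q <:+ H) : NodesOk next vert Q := by
  induction H with
  | nil => rw [List.suffix_nil.1 hQ]; trivial
  | cons e H ih =>
    rcases List.suffix_cons_iff.1 hQ with rfl | hQ
    · exact h
    · exact ih h.2.2 hQ

/-- The mathematical content of the memory: the current round, the scheduled removal time, the
round of the removal (`0` if there was none) and the stored degree of each vertex, and all pairs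
of a removal time and a vertex that were ever put into a bucket, the latest one first. -/
structure Snapshot (n : ℕ) where
  round : ℕ
  time : Fin n → ℕ
  removed : Fin n → ℕ
  deg : Fin n → ℕ
  log : List (ℕ × Fin n)

def Snapshot.start (n : ℕ) : Snapshot n := ⟨0, fun _ => 0, fun _ => 0, fun _ => 0, []⟩

@[simps] def Snapshot.schedule (m : Snapshot n) (v : Fin n) (x : ℕ) : Snapshot n :=
  { m with time := Function.update m.time v x, log := (x, v) :: m.log }

@[simps] def Snapshot.setDeg (m : Snapshot n) (v : Fin n) (d : ℕ) : Snapshot n :=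
  { m with deg := Function.update m.deg v d }

@[simps] def Snapshot.remove (m : Snapshot n) (v : Fin n) : Snapshot n :=
  { m with removed := Function.update m.removed v m.round }

@[simps] def Snapshot.advance (m : Snapshot n) : Snapshot n := { m with round := m.round + 1 }

/-- The vertices that are left after round `s`. -/
def Snapshot.aliveAt (m : Snapshot n) (s : ℕ) : Finset (Fin n) :=
  Finset.univ.filter fun v => m.removed v = 0 ∨ s < m.removed v

/-- The number of entries for later rounds. It is the potential that pays for looking at these
entries when their round comes. -/
def Snapshot.pending (m : Snapshot n) : ℕ := m.log.countP fun e => m.round < e.1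

theorem Snapshot.pending_eq_add (m : Snapshot n) :
    m.pending = m.advance.pending + m.log.countP fun e => e.1 = m.round + 1 := by
  simp only [Snapshot.pending, Snapshot.advance_round, Snapshot.advance_log]
  induction m.log with
  | nil => rfl
  | cons e H ih =>
    simp only [List.countP_cons, decide_eq_true_eq] at ih ⊢
    rw [ih]
    split_ifs <;> omega

theorem Snapshot.pending_schedule (m : Snapshot n) (v : Fin n) {x : ℕ} (hx : m.round < x) :
    (m.schedule v x).pending = m.pending + 1 :=
  List.countP_cons_of_pos (by simpa using hx)

attribute [local simp] Store.setNat Store.putNat Store.setReal NExp.eval RExp.eval BExp.holds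

/-- The store `σ` holds the input and the snapshot `m`. -/
structure Represents (nbrs : Fin n → List (Fin n)) (ε : ℝ) (thr : Fin n → ℝ) (m : Snapshot n)
    (σ : Store) : Prop where
  size : σ.natReg regSize = n
  starts : σ.natArr arrStart = (inputStore nbrs ε thr).natArr arrStart
  adj : σ.natArr arrAdj = (inputStore nbrs ε thr).natArr arrAdj
  eps : σ.realReg realRegEps = ε
  threshold : ∀ v : Fin n, σ.realArr realArrThr v = thr v
  round : σ.natReg regRound = m.round
  time : ∀ v : Fin n, σ.natArr arrTime v = m.time v
  removed : ∀ v : Fin n, σ.natArr arrRemoved v = m.removed v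
  deg : ∀ v : Fin n, σ.natArr arrDeg v = m.deg v
  nodes : σ.natReg regNodes = m.log.length
  first : ∀ x, σ.natArr arrFirst x = firstNode x m.log
  nodesOk : NodesOk (σ.natArr arrNext) (σ.natArr arrVertex) m.log

variable {ε : ℝ} {thr : Fin n → ℝ} {nbrs : Fin n → List (Fin n)} {m : Snapshot n} {σ : Store}

theorem represents_inputStore :
    Represents nbrs ε thr (Snapshot.start n) (inputStore nbrs ε thr) := by
  constructor <;> simp [inputStore, Snapshot.start, firstNode, NodesOk]

theorem Represents.setNat (h : Represents nbrs ε thr m σ) {r : ℕ}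
    (hr : r ≠ regSize ∧ r ≠ regRound ∧ r ≠ regNodes) (y : ℕ) :
    Represents nbrs ε thr m (σ.setNat r y) :=
  { h with
    size := (Function.update_of_ne hr.1.symm _ _).trans h.size
    round := (Function.update_of_ne hr.2.1.symm _ _).trans h.round
    nodes := (Function.update_of_ne hr.2.2.symm _ _).trans h.nodes }

theorem Represents.setReal (h : Represents nbrs ε thr m σ) {r : ℕ} (hr : r ≠ realRegEps) (y : ℝ) :
    Represents nbrs ε thr m (σ.setReal r y) :=
  { h with eps := (Function.update_of_ne hr.symm _ _).trans h.eps }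

theorem update_val_apply {f : ℕ → ℕ} {f' : Fin n → ℕ} (h : ∀ v : Fin n, f v = f' v) (w : Fin n)
    (y : ℕ) (v : Fin n) : Function.update f w y v = Function.update f' w y v := by
  simp only [Function.update_apply, Fin.val_inj, h]

theorem Represents.remove (h : Represents nbrs ε thr m σ) (v : Fin n) :
    Represents nbrs ε thr (m.remove v) (σ.putNat arrRemoved v m.round) :=
  { h with removed := by simpa using update_val_apply h.removed v m.round }

theorem Represents.setDeg (h : Represents nbrs ε thr m σ) (v : Fin n) (d : ℕ) :
    Represents nbrs ε thr (m.setDeg v d) (σ.putNat arrDeg v d) :=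
  { h with deg := by simpa using update_val_apply h.deg v d }

theorem Represents.advance (h : Represents nbrs ε thr m σ) :
    Represents nbrs ε thr m.advance (σ.setNat regRound (m.round + 1)) :=
  { h with size := h.size, round := rfl, nodes := h.nodes }

theorem Represents.schedule (h : Represents nbrs ε thr m σ) (v : Fin n) (x : ℕ) :
    Represents nbrs ε thr (m.schedule v x)
      (((((σ.putNat arrTime v x).setNat regNodes (m.log.length + 1)).putNat arrVertex
        (m.log.length + 1) v).putNat arrNext (m.log.length + 1) (firstNode x m.log)).putNat
          arrFirst x (m.log.length + 1)) := by
  refine { h with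
    size := h.size, round := h.round, nodes := rfl, time := ?_, first := ?_, nodesOk := ?_ }
  · simpa using update_val_apply h.time v x
  · intro y
    rcases eq_or_ne y x with rfl | hy
    · simp [firstNode]
    · simpa [firstNode, hy, hy.symm] using h.first y
  · refine ⟨by simp, by simp, h.nodesOk.congr (fun i hi => ?_) fun i hi => ?_⟩ <;>
      simp [show i ≠ m.log.length + 1 by omega]

section Rules

variable {K : List Cmd} {B : ℕ} {w : Fin n}

theorem Outputs.probCmd {ν : PMF (Option (List (Finset (Fin n))))} (hε : 0 < ε)
    (h : Represents nbrs ε thr m σ) (hw : σ.natReg regTarget = w)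
    (hK : ∀ y, Outputs n (K, (σ.setReal realRegArg y).setReal realRegProb
      (removalProb ε (m.deg w) (thr w))) B ν) :
    Outputs n (Peeling.probCmd :: K, σ) (B + 4) ν := by
  have hK := hK ((thr w - m.deg w) * ε / 8)
  rw [removalProb_eq hε] at hK
  have harg : RExp.eval σ (.div (.mul (.sub (.get realArrThr (.reg regTarget))
      (.ofNat (.get arrDeg (.reg regTarget)))) (.reg realRegEps)) (.ofNat (.const 8))) =
      (thr w - m.deg w) * ε / 8 := by
    have := h.threshold w
    have := h.deg w
    have := h.eps
    simp_all
  refine Outputs.seq (Outputs.setReal ?_)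
  rw [harg]
  refine Outputs.ite (fun hb => Outputs.setReal ?_) fun hb => Outputs.setReal ?_
  · rw [if_pos (by simpa using hb)] at hK
    simpa using hK
  · rw [if_neg (by simpa using hb)] at hK
    simpa using hK

theorem Outputs.scheduleCmd {ν : ℕ → PMF (Option (List (Finset (Fin n))))} (hε : 0 < ε)
    (h : Represents nbrs ε thr m σ) (hw : σ.natReg regTarget = w) {d : ℕ} (hd : m.deg w = d)
    (hK : ∀ σ' x, m.round < x → Represents nbrs ε thr (m.schedule w x) σ' →
      (∀ r, r ≠ regTime → r ≠ regNodes → σ'.natReg r = σ.natReg r) →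
      Outputs n (K, σ') B (ν x)) :
    Outputs n (Peeling.scheduleCmd :: K, σ) (B + 18)
      ((removalTimeLaw ε d (thr w) m.round).bind ν) := by
  subst hd
  refine Outputs.seq (Outputs.probCmd hε h hw fun y => Outputs.seq ?_)
  set σ₁ := (σ.setReal realRegArg y).setReal realRegProb (removalProb ε (m.deg w) (thr w))
  have h₁ : Represents nbrs ε thr m σ₁ := (h.setReal (by simp) _).setReal (by simp) _
  have hq : RExp.eval σ₁ (.reg realRegProb) = removalProb ε (m.deg w) (thr w) := by simp [σ₁]
  rw [removalTimeLaw, PMF.bind_map, ← hq]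
  refine Outputs.sampleGeom fun g hg => Outputs.seq (Outputs.setNat ?_)
  have hx : NExp.eval (σ₁.setNat regTime g) (.add (.reg regRound) (.reg regTime)) =
      m.round + g := by
    simpa using h₁.round
  rw [hx]
  set σ₂ := (σ₁.setNat regTime g).setNat regTime (m.round + g) with hσ₂
  have h₂ : Represents nbrs ε thr m σ₂ := (h₁.setNat (by simp) _).setNat (by simp) _
  have hreg : ∀ r, r ≠ regTime → σ₂.natReg r = σ.natReg r := fun r hr => by simp_all [σ₁]
  have hstored := hK _ (m.round + g) (Nat.lt_add_of_pos_right (one_le_of_mem_support_geom hg))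
    (h₂.schedule w (m.round + g)) fun r hr hr' => by simpa [hr'] using hreg r hr
  refine Outputs.seq (Outputs.putNat (Outputs.seq (Outputs.setNat (Outputs.seq (Outputs.putNat
    (Outputs.seq (Outputs.putNat (Outputs.putNat ?_))))))))
  have htime : σ₂.natReg 6 = m.round + g := by simp [hσ₂]
  have htarget : σ₂.natReg 5 = w := (hreg 5 (by simp)).trans hw
  have hnodes : σ₂.natReg 7 = m.log.length := h₂.nodes
  have hfirst : σ₂.natArr 5 (m.round + g) = firstNode (m.round + g) m.log := h₂.first _
  simpa [htime, htarget, hnodes, hfirst] using hstored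

end Rules

/-! ### The input -/

section Input

/-- The position at which the adjacency list of vertex `i` starts. -/
def listStart (nbrs : Fin n → List (Fin n)) (i : ℕ) : ℕ :=
  ((List.ofFn nbrs).take i).flatten.length

theorem inputStore_starts {i : ℕ} (hi : i ≤ n) :
    (inputStore nbrs ε thr).natArr arrStart i = listStart nbrs i := by
  simp [inputStore, hi, listStart]

theorem take_ofFn_succ {α : Type*} (f : Fin n → α) (v : Fin n) :
    (List.ofFn f).take (v + 1) = (List.ofFn f).take v ++ [f v] := by
  rw [List.take_succ_eq_append_getElem (by simp)]
  simp

theorem listStart_succ (v : Fin n) :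
    listStart nbrs (v + 1) = listStart nbrs v + (nbrs v).length := by
  rw [listStart, take_ofFn_succ]
  simp [listStart]

theorem inputStore_adj {v w : Fin n} {l L : List (Fin n)} (h : nbrs v = l ++ w :: L) :
    (inputStore nbrs ε thr).natArr arrAdj (listStart nbrs v + l.length) = w := by
  have hsplit : (List.ofFn nbrs).flatten = ((List.ofFn nbrs).take v).flatten ++
      (l ++ (w :: (L ++ ((List.ofFn nbrs).drop (v + 1)).flatten))) := by
    conv_lhs => rw [← List.take_append_drop (v + 1) (List.ofFn nbrs), take_ofFn_succ]
    simp [h]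
  simp only [inputStore, one_ne_zero, if_false, if_true]
  rw [hsplit, listStart, List.getD_eq_getElem?_getD, List.getElem?_map,
    List.getElem?_append_right (by omega), List.getElem?_append_right (by omega)]
  simp

theorem length_nbrs {G : SimpleGraph (Fin n)} (hadj : IsAdjacencyLists G nbrs) (v : Fin n) :
    (nbrs v).length = indDeg G Finset.univ v := by
  rw [indDeg, ← List.toFinset_card_of_nodup (hadj v).1]
  refine congrArg Finset.card (Finset.ext fun w => ?_)
  simp [mem_nbrsIn, (hadj v).2]

end Input

end Memory

/-! ### The invariant of the program -/

section Invariant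

variable {n : ℕ} {G : SimpleGraph (Fin n)} {S R : Finset (Fin n)} {L : List (Fin n)}
  {tr : List (Finset (Fin n))} {m : Snapshot n} {v w : Fin n}
  {nbrs : Fin n → List (Fin n)}

theorem insert_union_erase {ι : Type*} [DecidableEq ι] {S R : Finset ι} {w : ι}
    (hw : w ∈ S ∪ R) : insert w S ∪ R.erase w = S ∪ R := by
  ext v
  by_cases hv : v = w
  · simpa [hv] using hw
  · simp [hv]

theorem indDeg_union_erase (hadj : IsAdjacencyLists G nbrs) (hv : v ∈ R) (hvS : v ∉ S)
    (w : Fin n) :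
    indDeg G (S ∪ R) w = indDeg G (S ∪ R.erase v) w + if w ∈ nbrs v then 1 else 0 := by
  have hsplit : S ∪ R = insert v (S ∪ R.erase v) := by
    rw [← Finset.union_insert, Finset.insert_erase hv]
  have hvE : v ∉ nbrsIn G (S ∪ R.erase v) w := by simp [mem_nbrsIn, hvS]
  have hmem : w ∈ nbrs v ↔ G.Adj w v := ((hadj v).2 w).trans (G.adj_comm v w)
  rw [hsplit, indDeg, indDeg, nbrsIn, Finset.filter_insert]
  by_cases hwv : G.Adj w v
  · rw [if_pos hwv, if_pos (hmem.2 hwv)]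
    exact Finset.card_insert_of_notMem hvE
  · rw [if_neg hwv, if_neg (mt hmem.1 hwv)]
    rfl

/-- The invariant of the program. The current vertices are those of `S`, which stay, and those of
`R`, which are due in this round; the vertices in `L` are the neighbours of the last removed vertex
whose stored degrees have not been updated yet; `tr` lists the sets after the previous rounds. -/
structure Snapshot.Inv (G : SimpleGraph (Fin n)) (S R : Finset (Fin n)) (L : List (Fin n))
    (tr : List (Finset (Fin n))) (m : Snapshot n) : Prop where
  live : ∀ v, m.round < m.time v ↔ v ∈ S
  due : ∀ v ∈ R, m.time v = m.round
  mem_log : ∀ v ∈ S, (m.time v, v) ∈ m.log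
  deg : ∀ v ∈ S, m.deg v = indDeg G (S ∪ R) v + if v ∈ L then 1 else 0
  removed_eq_zero : ∀ v, m.removed v = 0 ↔ v ∈ S ∪ R
  removed_le : ∀ v, m.removed v ≤ m.round
  past : (List.range m.round).map m.aliveAt = tr

namespace Snapshot.Inv

theorem notMem_of_mem (h : m.Inv G S R L tr) (hv : v ∈ R) : v ∉ S := by
  rw [← h.live, h.due v hv]
  exact lt_irrefl _

theorem aliveAt_round (h : m.Inv G S R L tr) : m.aliveAt m.round = S ∪ R := by
  ext v
  simp [aliveAt, h.removed_eq_zero, (h.removed_le v).not_gt]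

theorem visit_iff (h : m.Inv G S R L tr) :
    m.time v = m.round ∧ m.removed v = 0 ↔ v ∈ R := by
  rw [h.removed_eq_zero, Finset.mem_union]
  refine ⟨fun ⟨htime, hv⟩ => hv.resolve_left ?_, fun hv => ⟨h.due v hv, Or.inr hv⟩⟩
  rw [← h.live, htime]
  exact lt_irrefl _

theorem cons_iff_of_notMem (hw : w ∉ S) : m.Inv G S R (w :: L) tr ↔ m.Inv G S R L tr := by
  have hmem : ∀ v ∈ S, v ∈ w :: L ↔ v ∈ L := fun v hv =>
    List.mem_cons.trans (or_iff_right (ne_of_mem_of_not_mem hv hw))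
  constructor <;> intro h <;>
    exact { h with deg := fun v hv => by simpa only [hmem v hv] using h.deg v hv }

theorem due_subset {V : Finset (Fin n)} (h : m.Inv G V ∅ [] tr) :
    Peeling.due m.time (m.round + 1) ⊆ V := by
  intro v hv
  rw [← h.live, mem_due.1 hv]
  exact lt_add_one _

theorem advance {V : Finset (Fin n)} (h : m.Inv G V ∅ [] tr) :
    m.advance.Inv G (V \ Peeling.due m.time (m.round + 1)) (Peeling.due m.time (m.round + 1)) []
      (tr ++ [V]) := by
  have hunion := Finset.sdiff_union_of_subset h.due_subset
  exact
  { live := fun v => by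
      rw [advance_round, advance_time, Finset.mem_sdiff, mem_due, ← h.live]
      omega
    due := fun v hv => mem_due.1 hv
    mem_log := fun v hv => h.mem_log v (Finset.mem_sdiff.1 hv).1
    deg := fun v hv => by
      simpa only [advance_deg, hunion, Finset.union_empty] using h.deg v (Finset.mem_sdiff.1 hv).1
    removed_eq_zero := fun v => by
      simpa only [advance_removed, hunion, Finset.union_empty] using h.removed_eq_zero v
    removed_le := fun v => Nat.le_succ_of_le (h.removed_le v)
    past := by
      have halive := h.aliveAt_round
      rw [Finset.union_empty] at halive
      change (List.range (m.round + 1)).map m.aliveAt = _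
      rw [List.range_succ, List.map_append, h.past, List.map_singleton, halive] }

theorem remove (h : m.Inv G S R [] tr) (hadj : IsAdjacencyLists G nbrs) (hround : 0 < m.round)
    (hv : v ∈ R) :
    (m.remove v).Inv G S (R.erase v) (nbrs v) tr where
  live := h.live
  due w hw := h.due w (Finset.mem_of_mem_erase hw)
  mem_log := h.mem_log
  deg w hw := by
    rw [← indDeg_union_erase hadj hv (h.notMem_of_mem hv)]
    simpa using h.deg w hw
  removed_eq_zero w := by
    by_cases hwv : w = v
    · simp [hwv, h.notMem_of_mem hv, hround.ne']
    · simpa [hwv] using h.removed_eq_zero w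
  removed_le w := by
    by_cases hwv : w = v
    · simp [hwv]
    · simpa [hwv] using h.removed_le w
  past := by
    have hzero : m.removed v = 0 := (h.removed_eq_zero v).2 (Finset.mem_union_right S hv)
    rw [← h.past]
    refine List.map_congr_left fun s hs => Finset.ext fun w => ?_
    by_cases hwv : w = v
    · simpa [aliveAt, hwv, hzero] using Or.inr (List.mem_range.1 hs)
    · simp [aliveAt, hwv]

theorem schedule (h : m.Inv G S R (w :: L) tr) (hw : w ∈ S ∪ R) (hwL : w ∉ L) {x : ℕ}
    (hx : m.round < x) :
    ((m.setDeg w (indDeg G (S ∪ R) w)).schedule w x).Inv G (insert w S) (R.erase w) L tr := by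
  have hunion := insert_union_erase hw
  refine
  { h with
    live := fun v => ?_
    due := fun v hv => ?_
    mem_log := fun v hv => ?_
    deg := fun v hv => ?_
    removed_eq_zero := hunion ▸ h.removed_eq_zero }
  · by_cases hvw : v = w
    · simp [hvw, hx]
    · simpa [hvw] using h.live v
  · obtain ⟨hvw, hvR⟩ := Finset.mem_erase.1 hv
    simpa [hvw] using h.due v hvR
  · by_cases hvw : v = w
    · simp [hvw]
    · simpa [hvw] using h.mem_log v (Finset.mem_of_mem_insert_of_ne hv hvw)
  · rw [hunion]
    by_cases hvw : v = w
    · simp [hvw, hwL]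
    · simpa [hvw] using h.deg v (Finset.mem_of_mem_insert_of_ne hv hvw)

end Snapshot.Inv

/-! ### The vertices that remain to be redrawn -/

variable (G S R L) in
/-- The vertices whose removal times have to be redrawn before the end of the round, when the
vertices of `R` are still to be removed and those of `L` still to be updated. -/
def stale : Finset (Fin n) := exposed G S R ∪ S.filter (· ∈ L)

theorem stale_nil : stale G S R [] = exposed G S R := by simp [stale]

theorem stale_cons_of_notMem (hw : w ∉ S) : stale G S R (w :: L) = stale G S R L := by
  refine congrArg (exposed G S R ∪ ·) (Finset.filter_congr fun v hv => ?_)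
  exact List.mem_cons.trans (or_iff_right (ne_of_mem_of_not_mem hv hw))

theorem stale_cons_of_mem (hw : w ∈ S) : stale G S R (w :: L) = insert w (stale G S R L) := by
  ext v
  simp only [stale, Finset.mem_union, Finset.mem_filter, List.mem_cons, Finset.mem_insert]
  constructor
  · tauto
  · rintro (rfl | h)
    · exact Or.inr ⟨hw, Or.inl rfl⟩
    · tauto

theorem stale_erase (hadj : IsAdjacencyLists G nbrs) (hv : v ∈ R) :
    stale G S (R.erase v) (nbrs v) = stale G S R [] := by
  rw [stale_nil]
  ext u
  simp only [stale, Finset.mem_union, mem_exposed, Finset.mem_filter, (hadj v).2, ← and_or_left]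
  refine and_congr_right fun _ => ?_
  constructor
  · rintro (⟨x, hx, hxu⟩ | hvu)
    · exact ⟨x, Finset.mem_of_mem_erase hx, hxu⟩
    · exact ⟨v, hv, hvu⟩
  · rintro ⟨x, hx, hxu⟩
    by_cases hxv : x = v
    · exact Or.inr (hxv ▸ hxu)
    · exact Or.inl ⟨x, Finset.mem_erase.2 ⟨hxv, hx⟩, hxu⟩

variable (G S R L) in
/-- The law of the removal times at the end of the round. -/
def finalTimes (ε : ℝ) (thr : Fin n → ℝ) (m : Snapshot n) : PMF (Fin n → ℕ) :=
  redraw (nextRemoval G ε thr S m.round) (stale G S R L) m.time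

variable {ε : ℝ} {thr : Fin n → ℝ}

theorem finalTimes_of_done : finalTimes G S ∅ [] ε thr m = PMF.pure m.time := by
  have hnone : exposed G S ∅ = ∅ := by ext; simp [mem_exposed]
  rw [finalTimes, stale_nil, hnone, redraw_empty]

theorem finalTimes_cons_of_notMem (hw : w ∉ S) :
    finalTimes G S R (w :: L) ε thr m = finalTimes G S R L ε thr m := by
  rw [finalTimes, finalTimes, stale_cons_of_notMem hw]

/-- The updated degree of `w` is right unless `w` is exposed, and then `w` is redrawn once more. -/
theorem finalTimes_cons_of_mem (hw : w ∈ S) {d : ℕ} (hd : d = indDeg G (S ∪ R) w) :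
    finalTimes G S R (w :: L) ε thr m = (removalTimeLaw ε d (thr w) m.round).bind fun x =>
      finalTimes G S R L ε thr ((m.setDeg w d).schedule w x) := by
  rw [finalTimes, stale_cons_of_mem hw]
  change _ = PMF.bind _ fun x => redraw (nextRemoval G ε thr S m.round) (stale G S R L)
    (Function.update m.time w x)
  by_cases hstale : w ∈ stale G S R L
  · simp only [Finset.insert_eq_of_mem hstale, redraw_update_of_mem _ hstale, PMF.bind_const]
  · have hdeg : indDeg G S w = d := hd ▸
      indDeg_eq_of_notMem_exposed G Finset.subset_union_left subset_rfl hw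
        fun hexp => hstale (Finset.mem_union_left _ hexp)
    rw [redraw_insert, nextRemoval, hdeg]

theorem finalTimes_remove (hadj : IsAdjacencyLists G nbrs) (hv : v ∈ R) :
    finalTimes G S (R.erase v) (nbrs v) ε thr (m.remove v) = finalTimes G S R [] ε thr m := by
  rw [finalTimes, stale_erase hadj hv]
  rfl

end Invariant

/-! ### The loops of the program -/

section Loops

variable {n : ℕ} {G : SimpleGraph (Fin n)} {ε : ℝ} {thr : Fin n → ℝ} {nbrs : Fin n → List (Fin n)}
  {S R V : Finset (Fin n)} {L : List (Fin n)} {Q : List (ℕ × Fin n)}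
  {tr : List (Finset (Fin n))} {m : Snapshot n}
  {σ : Store} {v w : Fin n} {K : List Cmd} {B : ℕ}
  {ν : (Fin n → ℕ) → PMF (Option (List (Finset (Fin n))))}

attribute [local simp] Store.setNat Store.putNat NExp.eval BExp.holds

/-- What updating neighbours leaves in place: the round, the old log entries, and all registers but
those used for the update. -/
structure Extends (m : Snapshot n) (σ : Store) (m' : Snapshot n) (σ' : Store) : Prop where
  round : m'.round = m.round
  log : m.log <:+ m'.log
  natReg : ∀ r ∉ [regPos, regTarget, regTime, regNodes], σ'.natReg r = σ.natReg r

theorem Extends.refl (m : Snapshot n) (σ : Store) : Extends m σ m σ :=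
  ⟨rfl, List.suffix_rfl, fun _ _ => rfl⟩

theorem Extends.trans {m₁ m₂ m₃ : Snapshot n} {σ₁ σ₂ σ₃ : Store} (h : Extends m₁ σ₁ m₂ σ₂)
    (h' : Extends m₂ σ₂ m₃ σ₃) : Extends m₁ σ₁ m₃ σ₃ :=
  ⟨h'.round.trans h.round, h.log.trans h'.log, fun r hr => (h'.natReg r hr).trans (h.natReg r hr)⟩

theorem Outputs.updateCmd (hε : 0 < ε) (h : Represents nbrs ε thr m σ)
    (hI : m.Inv G S R (w :: L) tr) (hwL : w ∉ L) (htarget : σ.natReg regTarget = w)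
    (hK : ∀ m' σ', Represents nbrs ε thr m' σ' → m'.Inv G S R L tr → Extends m σ m' σ' →
      σ'.natReg regPos = σ.natReg regPos →
      Outputs n (K, σ') (B + 8 * m'.pending) ((finalTimes G S R L ε thr m').bind ν)) :
    Outputs n (Peeling.updateCmd :: K, σ) (B + 8 * m.pending + 29)
      ((finalTimes G S R (w :: L) ε thr m).bind ν) := by
  have hskip : BExp.holds σ (.natLe (.get arrTime (.reg regTarget)) (.reg regRound)) ↔ w ∉ S := by
    have htime := h.time w
    have hround := h.round
    rw [← hI.live]
    simp_all
  refine Outputs.ite (fun hb => ?_) fun hb => ?_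
  · have hwS := hskip.1 hb
    rw [finalTimes_cons_of_notMem hwS]
    exact ((hK m σ h ((Snapshot.Inv.cons_iff_of_notMem hwS).1 hI) (.refl m σ) rfl).skip).mono
      (by omega)
  · have hwS : w ∈ S := not_not.1 (mt hskip.2 hb)
    have hdeg : m.deg w - 1 = indDeg G (S ∪ R) w := by simp [hI.deg w hwS]
    have hdec : NExp.eval σ (.sub (.get arrDeg (.reg regTarget)) (.const 1)) =
        indDeg G (S ∪ R) w := by
      have := h.deg w
      simp_all
    have hwR : w ∉ R := fun hwR => hI.notMem_of_mem hwR hwS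
    refine Outputs.mono (B := B + 8 * m.pending + 8 + 18 + 1 + 1) ?_ (by omega)
    refine Outputs.seq (Outputs.putNat ?_)
    rw [hdec, show NExp.eval σ (.reg regTarget) = w from htarget,
      finalTimes_cons_of_mem hwS rfl, PMF.bind_bind]
    refine Outputs.scheduleCmd hε (h.setDeg w (indDeg G (S ∪ R) w)) htarget (by simp)
      fun σ' x hx h' hreg => ?_
    have hI' := hI.schedule (Finset.mem_union_left R hwS) hwL hx
    rw [Finset.insert_eq_of_mem hwS, Finset.erase_eq_of_notMem hwR] at hI'
    refine (hK _ σ' h' hI' ⟨rfl, List.suffix_cons _ _, fun r hr => hreg r ?_ ?_⟩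
      (hreg _ (by simp) (by simp))).mono ?_
    · aesop
    · aesop
    · rw [Snapshot.pending_schedule _ w hx]
      change B + 8 * (m.pending + 1) ≤ _
      omega

theorem Outputs.scanBody (hε : 0 < ε) (h : Represents nbrs ε thr m σ)
    (hI : m.Inv G S R (w :: L) tr) (hwL : w ∉ L) (hw : σ.natArr arrAdj (σ.natReg regPos) = w)
    (hK : ∀ m' σ', Represents nbrs ε thr m' σ' → m'.Inv G S R L tr → Extends m σ m' σ' →
      σ'.natReg regPos = σ.natReg regPos + 1 →
      Outputs n (K, σ') (B + 8 * m'.pending) ((finalTimes G S R L ε thr m').bind ν)) :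
    Outputs n (Peeling.scanBody :: K, σ) (B + 8 * m.pending + 33)
      ((finalTimes G S R (w :: L) ε thr m).bind ν) := by
  refine Outputs.seq (Outputs.setNat (Outputs.seq ?_))
  rw [show NExp.eval σ (.get arrAdj (.reg regPos)) = w from hw]
  refine (Outputs.updateCmd (B := B + 1) hε (h.setNat (by simp) w) hI hwL (by simp)
    fun m' σ' h' hI' hext hpos => ?_).mono (by omega)
  have hnext := hK m' (σ'.setNat regPos (σ.natReg regPos + 1)) (h'.setNat (by simp) _) hI'
    (.trans ⟨rfl, List.suffix_rfl, fun r hr => ?_⟩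
      (hext.trans ⟨rfl, List.suffix_rfl, fun r hr => ?_⟩)) (by simp)
  · refine (Outputs.setNat ?_).mono (show B + 8 * m'.pending + 1 ≤ _ by omega)
    simpa [hpos] using hnext
  · simp_all
  · simp_all

theorem scanLoop_holds_iff {l L : List (Fin n)} (h : Represents nbrs ε thr m σ)
    (hl : nbrs v = l ++ L) (hv : σ.natReg regVertex = v)
    (hpos : σ.natReg regPos = listStart nbrs v + l.length) :
    BExp.holds σ (.not (.natLe (.get arrStart (.add (.reg regVertex) (.const 1)))
      (.reg regPos))) ↔ L ≠ [] := by
  simp only [BExp.holds, NExp.eval, hv, hpos, h.starts,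
    inputStore_starts (Nat.succ_le_of_lt v.2), listStart_succ, hl, List.length_append,
    ← List.length_pos_iff]
  omega

theorem Outputs.scanLoop (hε : 0 < ε) (hv : σ.natReg regVertex = v) {l : List (Fin n)}
    (hl : nbrs v = l ++ L) (hnodup : (nbrs v).Nodup) (h : Represents nbrs ε thr m σ)
    (hI : m.Inv G S R L tr) (hpos : σ.natReg regPos = listStart nbrs v + l.length)
    (hK : ∀ m' σ', Represents nbrs ε thr m' σ' → m'.Inv G S R [] tr → Extends m σ m' σ' →
      Outputs n (K, σ') (B + 8 * m'.pending) ((finalTimes G S R [] ε thr m').bind ν)) :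
    Outputs n (Peeling.scanLoop :: K, σ) (B + 8 * m.pending + 34 * L.length + 1)
      ((finalTimes G S R L ε thr m).bind ν) := by
  induction L generalizing l m σ with
  | nil =>
    refine Outputs.while_false (mt (scanLoop_holds_iff h hl hv hpos).1 (by simp)) ?_
    exact (hK m σ h hI (.refl m σ)).mono (by simp)
  | cons w L ih =>
    have hwL : w ∉ L := by
      rw [hl, List.nodup_append] at hnodup
      exact (List.nodup_cons.1 hnodup.2.1).1
    refine (Outputs.while_true ((scanLoop_holds_iff h hl hv hpos).2 (by simp))
      (Outputs.scanBody (B := B + 34 * L.length + 1) hε h hI hwL ?_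
        fun m' σ' h' hI' hext hpos' => ?_)).mono (by simp only [List.length_cons]; omega)
    · rw [hpos, h.adj]
      exact inputStore_adj hl
    · refine (ih (l := l ++ [w]) ?_ (by simp [hl]) h' hI' ?_
        fun m'' σ'' h'' hI'' hext' => hK m'' σ'' h'' hI'' (hext.trans hext')).mono (by omega)
      · rw [hext.natReg _ (by simp), hv]
      · rw [hpos', hpos, List.length_append, List.length_singleton, add_assoc]

theorem Outputs.visitCmd (hε : 0 < ε) (hadj : IsAdjacencyLists G nbrs)
    (h : Represents nbrs ε thr m σ) (hI : m.Inv G S R [] tr) (hround : 0 < m.round)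
    (hv : σ.natReg regVertex = v) (hvR : v ∈ R)
    (hK : ∀ m' σ', Represents nbrs ε thr m' σ' → m'.Inv G S (R.erase v) [] tr →
      Extends m (σ.setNat regFlag 1) m' σ' →
      Outputs n (K, σ') (B + 8 * m'.pending) ((finalTimes G S (R.erase v) [] ε thr m').bind ν)) :
    Outputs n (Peeling.visitCmd :: K, σ) (B + 8 * m.pending + 34 * (nbrs v).length + 7)
      ((finalTimes G S R [] ε thr m).bind ν) := by
  rw [← finalTimes_remove hadj hvR]
  refine Outputs.seq (Outputs.putNat (Outputs.seq (Outputs.setNat (Outputs.seq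
    (Outputs.setNat ?_)))))
  rw [show NExp.eval σ (.reg regVertex) = v from hv,
    show NExp.eval σ (.reg regRound) = m.round from h.round]
  set σ₁ := (σ.putNat arrRemoved v m.round).setNat regFlag 1 with hσ₁
  have h₁ : Represents nbrs ε thr (m.remove v) σ₁ := (h.remove v).setNat (by simp) 1
  have hv₁ : σ₁.natReg regVertex = v := by simpa [hσ₁] using hv
  have hstart : NExp.eval σ₁ (.get arrStart (.reg regVertex)) = listStart nbrs v := by
    rw [← inputStore_starts (ε := ε) (thr := thr) v.2.le, ← h₁.starts, ← hv₁]
    rfl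
  refine Outputs.scanLoop (m := m.remove v) (l := []) hε ?_ rfl (hadj v).1 (h₁.setNat (by simp) _)
    (hI.remove hadj hround hvR) ?_ fun m' σ' h' hI' hext => hK m' σ' h' hI'
      (.trans (m₂ := m.remove v) ⟨rfl, List.suffix_rfl, fun r hr => ?_⟩ hext)
  · simpa [hσ₁] using hv₁
  · simpa [hσ₁] using hstart
  · simp_all

/-- A bound on the steps that the visits of the vertices in `R` take, apart from redrawing. -/
def visitCost (nbrs : Fin n → List (Fin n)) (R : Finset (Fin n)) : ℕ :=
  ∑ v ∈ R, (8 + 34 * (nbrs v).length)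

theorem visitCost_erase_add (nbrs : Fin n → List (Fin n)) (hv : v ∈ R) :
    visitCost nbrs (R.erase v) + (8 + 34 * (nbrs v).length) = visitCost nbrs R :=
  Finset.sum_erase_add R _ hv

theorem Outputs.bucketBody (hε : 0 < ε) (hadj : IsAdjacencyLists G nbrs)
    (h : Represents nbrs ε thr m σ) (hI : m.Inv G S R [] tr) (hround : 0 < m.round) {x : ℕ}
    (hQ : (x, v) :: Q <:+ m.log) (hnode : σ.natReg regNode = Q.length + 1)
    (hK : ∀ m' σ', Represents nbrs ε thr m' σ' → m'.Inv G S (R.erase v) [] tr →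
      m'.round = m.round → m.log <:+ m'.log → σ'.natReg regNode = firstNode x Q →
      σ'.natReg regFlag = (if v ∈ R then 1 else σ.natReg regFlag) →
      Outputs n (K, σ') (B + 8 * m'.pending + visitCost nbrs (R.erase v))
        ((finalTimes G S (R.erase v) [] ε thr m').bind ν)) :
    Outputs n (Peeling.bucketBody :: K, σ) (B + 8 * m.pending + visitCost nbrs R + 6)
      ((finalTimes G S R [] ε thr m).bind ν) := by
  have hvert : σ.natArr arrVertex (Q.length + 1) = v := (h.nodesOk.of_suffix hQ).1
  refine Outputs.seq (Outputs.setNat (Outputs.seq ?_))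
  rw [show NExp.eval σ (.get arrVertex (.reg regNode)) = v by simp [hnode, hvert]]
  set σ₁ := σ.setNat regVertex v with hσ₁
  have h₁ : Represents nbrs ε thr m σ₁ := h.setNat (by simp) v
  have hv₁ : σ₁.natReg regVertex = v := by simp [hσ₁]
  have hnext : ∀ {m' σ'}, Represents nbrs ε thr m' σ' → m'.Inv G S (R.erase v) [] tr →
      Extends m (if v ∈ R then σ₁.setNat regFlag 1 else σ₁) m' σ' →
      Outputs n (.setNat regNode (.get arrNext (.reg regNode)) :: K, σ')
        (B + 8 * m'.pending + visitCost nbrs (R.erase v) + 1)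
        ((finalTimes G S (R.erase v) [] ε thr m').bind ν) := by
    intro m' σ' h' hI' hext
    have hnode' := hext.natReg regNode (by simp)
    have hflag' := hext.natReg regFlag (by simp)
    refine Outputs.setNat (hK m' _ (h'.setNat (by simp) _) hI' hext.round hext.log ?_ ?_)
    · have hsucc := (h'.nodesOk.of_suffix (hQ.trans hext.log)).2.1
      split_ifs at hnode' <;> simp_all
    · split_ifs at hflag' ⊢ <;> simp_all
  have htest : BExp.holds σ₁ visitTest ↔ v ∈ R := by
    have hround₁ : σ₁.natReg regRound = m.round := h₁.round
    rw [← hI.visit_iff, le_antisymm_iff]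
    simp only [visitTest, BExp.holds, NExp.eval, hv₁, h₁.time, h₁.removed, hround₁,
      Nat.le_zero]
  refine Outputs.ite (fun hb => ?_) fun hb => ?_
  · have hvR := htest.1 hb
    have hcost := visitCost_erase_add nbrs hvR
    simp only [hvR, if_true] at hnext
    exact (Outputs.visitCmd (B := B + visitCost nbrs (R.erase v) + 1) hε hadj h₁ hI hround hv₁ hvR
      fun m' σ' h' hI' hext => (hnext h' hI' hext).mono (by omega)).mono (by omega)
  · have hvR := mt htest.2 hb
    rw [Finset.erase_eq_of_notMem hvR] at hnext
    simp only [hvR, if_false] at hnext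
    exact (hnext h₁ hI (.refl m σ₁)).skip

theorem Outputs.bucketLoop (hε : 0 < ε) (hadj : IsAdjacencyLists G nbrs)
    (h : Represents nbrs ε thr m σ) (hI : m.Inv G S R [] tr) (hround : 0 < m.round)
    (hQ : Q <:+ m.log) (hnode : σ.natReg regNode = firstNode m.round Q)
    (hR : ∀ v ∈ R, (m.round, v) ∈ Q)
    (hK : ∀ m' σ', Represents nbrs ε thr m' σ' → m'.Inv G S ∅ [] tr → m'.round = m.round →
      (σ'.natReg regFlag = 0 ↔ σ.natReg regFlag = 0 ∧ R = ∅) →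
      Outputs n (K, σ') (B + 8 * m'.pending) (ν m'.time)) :
    Outputs n (Peeling.bucketLoop :: K, σ)
      (B + 8 * m.pending + visitCost nbrs R + 8 * (Q.countP fun e => e.1 = m.round) + 1)
      ((finalTimes G S R [] ε thr m).bind ν) := by
  induction Q generalizing m σ R with
  | nil =>
    obtain rfl : R = ∅ := Finset.eq_empty_of_forall_notMem fun v hv => by simpa using hR v hv
    rw [finalTimes_of_done, PMF.pure_bind]
    refine Outputs.while_false (by simpa [firstNode] using hnode) ?_
    exact (hK m σ h hI rfl (by simp)).mono (by omega)
  | cons e Q ih =>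
    obtain ⟨x, v⟩ := e
    by_cases hx : x = m.round
    · subst hx
      have hnode₁ : σ.natReg regNode = Q.length + 1 := by simpa [firstNode] using hnode
      refine (Outputs.while_true (by simp [hnode₁]) (Outputs.bucketBody
        (B := B + 8 * (Q.countP fun e => e.1 = m.round) + 1) hε hadj h hI hround hQ hnode₁
        fun m' σ' h' hI' hround' hlog hnode' hflag => ?_)).mono
          (by rw [List.countP_cons_of_pos (by simp)]; omega)
      rw [← hround'] at hround hnode'
      refine (ih h' hI' hround ((List.suffix_cons _ Q).trans (hQ.trans hlog)) hnode'
        (fun u hu => ?_) fun m'' σ'' h'' hI'' hround'' hflag'' => ?_).mono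
          (by rw [hround']; omega)
      · obtain ⟨huv, huR⟩ := Finset.mem_erase.1 hu
        simpa [huv, hround'] using hR u huR
      · refine hK m'' σ'' h'' hI'' (hround''.trans hround') (hflag''.trans ?_)
        by_cases hvR : v ∈ R
        · simp [hflag, hvR, Finset.ne_empty_of_mem hvR]
        · simp [hflag, hvR]
    · rw [List.countP_cons_of_neg (by simpa using hx)]
      exact ih h hI hround ((List.suffix_cons _ Q).trans hQ) (by simpa [firstNode, hx] using hnode)
        (fun u hu => by simpa [Ne.symm hx] using hR u hu) hK

theorem Outputs.roundBody (hε : 0 < ε) (hadj : IsAdjacencyLists G nbrs)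
    (h : Represents nbrs ε thr m σ) (hI : m.Inv G V ∅ [] tr) (hR : due m.time (m.round + 1) = R)
    (hK : ∀ m' σ', Represents nbrs ε thr m' σ' → m'.Inv G (V \ R) ∅ [] (tr ++ [V]) →
      m'.round = m.round + 1 → (σ'.natReg regFlag = 0 ↔ R = ∅) →
      Outputs n (K, σ') (B + 8 * m'.pending) (ν m'.time)) :
    Outputs n (Peeling.roundBody :: K, σ) (B + 8 * m.pending + visitCost nbrs R + 7)
      ((redraw (nextRemoval G ε thr (V \ R) (m.round + 1)) (exposed G (V \ R) R) m.time).bind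
        ν) := by
  subst hR
  have hpending := m.pending_eq_add
  refine Outputs.mono (B := B + 8 * m.advance.pending + visitCost nbrs (due m.time (m.round + 1)) +
    8 * (m.log.countP fun e => e.1 = m.round + 1) + 1 + 6) ?_ (by omega)
  refine Outputs.seq (Outputs.setNat (Outputs.seq (Outputs.setNat (Outputs.seq
    (Outputs.setNat ?_)))))
  have hround : NExp.eval (σ.setNat regFlag 0) (.add (.reg regRound) (.const 1)) = m.round + 1 := by
    simpa using h.round
  rw [show NExp.eval σ (.const 0) = 0 from rfl, hround, ← stale_nil]
  set σ₁ := (σ.setNat regFlag 0).setNat regRound (m.round + 1) with hσ₁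
  have h₁ : Represents nbrs ε thr m.advance σ₁ := (h.setNat (by simp) 0).advance
  have hnode : NExp.eval σ₁ (.get arrFirst (.reg regRound)) = firstNode (m.round + 1) m.log :=
    h₁.first _
  rw [hnode]
  refine Outputs.bucketLoop hε hadj (h₁.setNat (by simp) _) hI.advance (Nat.succ_pos _)
    List.suffix_rfl (by simp) (fun v hv => ?_) fun m' σ' h' hI' hround' hflag' =>
      hK m' σ' h' hI' hround' (hflag'.trans ?_)
  · have hlog := hI.mem_log v (hI.due_subset hv)
    rwa [mem_due.1 hv] at hlog
  · simp [hσ₁]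

theorem outputTrace_eq (h : Represents nbrs ε thr m σ) (hI : m.Inv G V ∅ [] tr) :
    outputTrace n ([], σ) = some (tr ++ [V]) := by
  have hlast := hI.aliveAt_round
  rw [Finset.union_empty] at hlast
  have hround : σ.natReg 1 = m.round := h.round
  have hremoved : ∀ v : Fin n, σ.natArr 2 v = m.removed v := h.removed
  simp only [outputTrace, List.isEmpty_nil, if_true, hround, hremoved]
  rw [← hI.past, ← hlast, ← List.map_singleton, ← List.map_append, ← List.range_succ]
  rfl

theorem Outputs.mainLoop (hε : 0 < ε) (hadj : IsAdjacencyLists G nbrs)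
    (h : Represents nbrs ε thr m σ) (hI : m.Inv G V ∅ [] tr) (hflag : 0 < σ.natReg regFlag)
    {k : ℕ} (hk : V.card < k) :
    Outputs n ([Peeling.mainLoop], σ) (8 * m.pending + visitCost nbrs V + 8 * V.card + 9)
      ((lazyRun G ε thr (fun V R => exposed G (V \ R) R) k m.round V m.time (tr ++ [V])).map
        (some ∘ Prod.fst)) := by
  induction k generalizing m σ V tr with
  | zero => exact absurd hk (Nat.not_lt_zero _)
  | succ k ih =>
    obtain ⟨R, hR⟩ : ∃ R, due m.time (m.round + 1) = R := ⟨_, rfl⟩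
    have hRV : R ⊆ V := hR ▸ hI.due_subset
    have htest : BExp.holds σ (.natLe (.const 1) (.reg regFlag)) := hflag
    have hcard := Finset.card_sdiff_add_card_eq_card hRV
    have hcost : visitCost nbrs (V \ R) + visitCost nbrs R = visitCost nbrs V :=
      Finset.sum_sdiff hRV
    simp only [lazyRun, hR, Finset.sdiff_sdiff_eq_self hRV]
    split_ifs with hRe
    · rw [PMF.pure_map, ← PMF.bind_const (redraw (nextRemoval G ε thr (V \ R) (m.round + 1))
        (exposed G (V \ R) R) m.time) (PMF.pure _)]
      refine (Outputs.while_true htest (Outputs.roundBody (B := 1) hε hadj h hI hR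
        fun m' σ' h' hI' _ hflag' => ?_)).mono (by omega)
      rw [Function.comp_apply, ← outputTrace_eq h' hI']
      exact (Outputs.while_false (by simpa using hflag'.2 hRe) (Outputs.halt 0 σ')).mono (by omega)
    · rw [PMF.map_bind]
      have hpos := Finset.card_pos.2 (Finset.nonempty_iff_ne_empty.2 hRe)
      refine (Outputs.while_true htest (Outputs.roundBody
        (B := visitCost nbrs (V \ R) + 8 * (V \ R).card + 9) hε hadj h hI hR
        fun m' σ' h' hI' hround' hflag' => ?_)).mono (by omega)
      rw [← hround']
      exact (ih h' hI' (Nat.pos_of_ne_zero (mt hflag'.1 hRe)) (by omega)).mono (by omega)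

theorem Outputs.initBody (hε : 0 < ε) (hadj : IsAdjacencyLists G nbrs)
    (h : Represents nbrs ε thr m σ) (hI : m.Inv G Rᶜ R [] tr) (hv : v ∈ R)
    (htarget : σ.natReg regTarget = v)
    (hK : ∀ m' σ', Represents nbrs ε thr m' σ' → m'.Inv G (R.erase v)ᶜ (R.erase v) [] tr →
      m'.round = m.round → σ'.natReg regTarget = v + 1 →
      Outputs n (K, σ') (B + 8 * m'.pending)
        ((redraw (nextRemoval G ε thr Finset.univ m.round) (R.erase v) m'.time).bind ν)) :
    Outputs n (Peeling.initBody :: K, σ) (B + 8 * m.pending + 30)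
      ((redraw (nextRemoval G ε thr Finset.univ m.round) R m.time).bind ν) := by
  have hunion : Rᶜ ∪ R = Finset.univ := by rw [Finset.union_comm, Finset.union_compl]
  have hdeg : NExp.eval σ (.sub (.get arrStart (.add (.reg regTarget) (.const 1)))
      (.get arrStart (.reg regTarget))) = indDeg G Finset.univ v := by
    simp only [NExp.eval, htarget, h.starts, inputStore_starts v.2.le,
      inputStore_starts (Nat.succ_le_of_lt v.2), listStart_succ, length_nbrs hadj]
    omega
  have hI' {x : ℕ} (hx : m.round < x) := ((Snapshot.Inv.cons_iff_of_notMem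
    (Finset.notMem_compl.2 hv)).2 hI).schedule (hunion ▸ Finset.mem_univ v) List.not_mem_nil hx
  rw [hunion, ← Finset.compl_erase] at hI'
  rw [← Finset.insert_erase hv, redraw_insert, PMF.bind_bind]
  refine Outputs.mono (B := B + 8 * (m.pending + 1) + 1 + 18 + 3) ?_ (by omega)
  refine Outputs.seq (Outputs.putNat (Outputs.seq ?_))
  rw [hdeg, show NExp.eval σ (.reg regTarget) = v from htarget]
  refine Outputs.scheduleCmd hε (h.setDeg v _) htarget (by simp) fun σ' x hx h' hreg =>
    Outputs.setNat ?_
  have htarget' : NExp.eval σ' (.add (.reg regTarget) (.const 1)) = v + 1 := by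
    simpa using (hreg regTarget (by simp) (by simp)).trans htarget
  rw [htarget']
  exact (hK _ _ (h'.setNat (by simp) _) (hI' hx) rfl (by simp)).mono
    (by rw [Snapshot.pending_schedule _ v hx]; rfl)

theorem Outputs.initLoop (hε : 0 < ε) (hadj : IsAdjacencyLists G nbrs)
    (h : Represents nbrs ε thr m σ) (hI : m.Inv G Rᶜ R [] tr) {i j : ℕ} (hij : i + j = n)
    (htarget : σ.natReg regTarget = i) (hR : ∀ v : Fin n, v ∈ R ↔ i ≤ v)
    (hK : ∀ m' σ', Represents nbrs ε thr m' σ' → m'.Inv G Finset.univ ∅ [] tr →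
      m'.round = m.round → Outputs n (K, σ') (B + 8 * m'.pending) (ν m'.time)) :
    Outputs n (Peeling.initLoop :: K, σ) (B + 8 * m.pending + 31 * j + 1)
      ((redraw (nextRemoval G ε thr Finset.univ m.round) R m.time).bind ν) := by
  have htest : BExp.holds σ (.not (.natLe (.reg regSize) (.reg regTarget))) ↔ j ≠ 0 := by
    simp only [BExp.holds, NExp.eval, h.size, htarget]
    omega
  induction j generalizing i m σ R with
  | zero =>
    obtain rfl : R = ∅ := Finset.eq_empty_of_forall_notMem fun v hv => by
      have := (hR v).1 hv
      omega
    rw [redraw_empty, PMF.pure_bind]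
    rw [Finset.compl_empty] at hI
    exact Outputs.while_false (by simpa using htest) (hK m σ h hI rfl)
  | succ j ih =>
    obtain ⟨v, rfl⟩ : ∃ v : Fin n, (v : ℕ) = i := ⟨⟨i, by omega⟩, rfl⟩
    refine (Outputs.while_true (htest.2 (Nat.succ_ne_zero j)) (Outputs.initBody
      (B := B + 31 * j + 1) hε hadj h hI ((hR v).2 le_rfl) htarget
      fun m' σ' h' hI' hround' htarget' => ?_)).mono (by omega)
    rw [← hround']
    refine (ih h' hI' (i := v + 1) (by omega) htarget' (fun u => ?_)
      (fun m'' σ'' h'' hI'' hround'' => hK m'' σ'' h'' hI'' (hround''.trans hround')) ?_).mono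
        (by omega)
    · rw [Finset.mem_erase, hR, Fin.ne_iff_vne]
      omega
    · simp only [BExp.holds, NExp.eval, h'.size, htarget']
      omega

theorem Snapshot.inv_start : (Snapshot.start n).Inv G Finset.univᶜ Finset.univ [] [] := by
  constructor <;> simp [Snapshot.start]

theorem visitCost_univ (hadj : IsAdjacencyLists G nbrs) :
    visitCost nbrs Finset.univ = 8 * n + 68 * G.edgeSet.ncard := by
  simp only [visitCost, length_nbrs hadj, Finset.sum_add_distrib, ← Finset.mul_sum,
    sum_indDeg_univ, Finset.sum_const, Finset.card_univ, Fintype.card_fin, smul_eq_mul]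
  ring

theorem map_trace_effRun (hε : 0 < ε) (k : ℕ) :
    (effRun G ε thr k).map LoopCfg.trace = (redraw (nextRemoval G ε thr Finset.univ 0) Finset.univ
      fun _ => 0).bind fun τ => (lazyRun G ε thr (fun V R => exposed G (V \ R) R) k 0 Finset.univ τ
        [Finset.univ]).map Prod.fst := by
  rw [← PMF.map_bind, redraw_bind_lazyRun G ε thr hε fun _ _ => subset_rfl,
    show [Finset.univ] = [id Finset.univ] from rfl, ← loopRun_eq_loopFrom, ← naiveRun,
    ← map_observe_effRun G ε thr hε, PMF.map_comp]
  rfl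

theorem outputs_program (hε : 0 < ε) (hadj : IsAdjacencyLists G nbrs) :
    Outputs n ([program], inputStore nbrs ε thr) (100 * (n + G.edgeSet.ncard + 1))
      ((effRun G ε thr (n + 1)).map fun c => some c.trace) := by
  have hlaw := congrArg (PMF.map some) (map_trace_effRun (G := G) (thr := thr) hε (n + 1))
  rw [PMF.map_comp, PMF.map_bind] at hlaw
  simp only [PMF.map_comp] at hlaw
  have hcost := visitCost_univ hadj
  change Outputs n _ _ (PMF.map (some ∘ LoopCfg.trace) _)
  rw [hlaw]
  refine Outputs.mono (B := visitCost nbrs Finset.univ + 8 * n + 11 + 31 * n + 1 + 1) ?_ (by omega)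
  refine Outputs.seq (Outputs.initLoop (B := visitCost nbrs Finset.univ + 8 * n + 11) hε hadj
    represents_inputStore Snapshot.inv_start (zero_add n) (by simp [inputStore]) (by simp)
    fun m σ h hI hround => ?_)
  have hmain := Outputs.mainLoop (tr := []) hε hadj (h.setNat (r := regFlag) (by simp) 1) hI
    (by simp) (k := n + 1) (by simp)
  rw [hround, Finset.card_univ, Fintype.card_fin] at hmain
  exact (Outputs.seq (Outputs.setNat hmain)).mono (by omega)

end Loops

end Peeling

end

theorem mainTheorem9 :
    (∀ (n : ℕ) (G : SimpleGraph (Fin n)) (ε : ℝ) (hε : 0 < ε) (thr : Fin n → ℝ),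
      (∀ k : ℕ, (Peeling.effRun G ε thr k).map Peeling.LoopCfg.observe =
        (Peeling.naiveRun G ε hε thr k).map Peeling.LoopCfg.observe) ∧
      (∀ c ∈ (Peeling.effRun G ε thr (n + 1)).support, c.done = true) ∧
      (∀ c ∈ (Peeling.naiveRun G ε hε thr (n + 1)).support, c.done = true) ∧
      (Peeling.effRun G ε thr (n + 1)).map (fun c => c.state.V) =
        (Peeling.naiveRun G ε hε thr (n + 1)).map (fun c => c.state)) ∧
    (∃ C : ℕ, ∀ (n : ℕ) (G : SimpleGraph (Fin n)) (ε : ℝ), 0 < ε → ∀ (thr : Fin n → ℝ),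
      ∀ c ∈ (Peeling.effRun G ε thr (n + 1)).support,
        c.state.work ≤ C * (n + G.edgeSet.ncard + 1)) ∧
    ∃ (P : Peeling.Cmd) (C a : ℕ),
      ∀ (n : ℕ) (G : SimpleGraph (Fin n)) (ε : ℝ), 0 < ε → ∀ (thr : Fin n → ℝ)
        (nbrs : Fin n → List (Fin n)), Peeling.IsAdjacencyLists G nbrs →
        (Peeling.runFor ([P], Peeling.inputStore nbrs ε thr)
            (C * (n + G.edgeSet.ncard + 1) * Nat.log 2 (n + G.edgeSet.ncard + 2) ^ a)).map
            (Peeling.outputTrace n) =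
          (Peeling.effRun G ε thr (n + 1)).map (fun c => some c.trace) := by
  exact ⟨fun n G ε hε thr => ⟨Peeling.map_observe_effRun G ε thr hε,
      Peeling.done_of_mem_support_effRun G ε thr hε,
      Peeling.done_of_mem_support_naiveRun G ε thr hε,
      Peeling.map_V_effRun G ε thr hε (n + 1)⟩,
    ⟨8, fun n G ε _ thr => Peeling.work_le_of_mem_support_effRun G ε thr⟩,
    Peeling.program, 100, 0, fun n G ε hε thr nbrs hadj =>
      Peeling.outputs_program hε hadj _ (by simp)⟩
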